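/- Let $n\ge 3$ and $m\ge 2$ be integers, let $g$ be the Riemannian metric on the unit sphere $\mathbb S^n\subset\mathbb R^{n+1}$ inherited from $\mathbb R^{n+1}$, with geodesic distance $d_g$, gradient $\nabla_g$ and volume $\mathrm dv_g$, and let $\mathbb S^n_+=\{y\in\mathbb S^n: y_{n+1}>0\}$ be the open upper hemisphere. Let $H^1_g(\mathbb S^n_+)$ be the completion of $C_0^\infty(\mathbb S^n_+)$ with respect to the norm $\big(\|u\|_{L^2}^2+\|\nabla_g u\|_{L^2}^2\big)^{1/2}$. Let $x_1,\dots,x_m\in\mathbb S^n_+$ be pairwise distinct points, write $d_i=d_g(\cdot,x_i)$, and let $\beta=\max_{1\le i\le m}d_g(x_0,x_i)$, where $x_0=(0,\dots,0,1)$ is the north pole. Put $$C(n,\beta)=(n-1)(n-2)\,\frac{7\pi^2-3\left(\beta+\frac{\pi}{2}\right)^2}{2\pi^2\left(\pi^2-\left(\beta+\frac{\pi}{2}\right)^2\right)}.$$ Then for every $u\in H^1_g(\mathbb S^n_+)$ the integrals on the right-hand side below are finite, and $$\int_{\mathbb S^n_+}|\nabla_g u|^2\,\mathrm dv_g+C(n,\beta)\int_{\mathbb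 S^n_+}u^2\,\mathrm dv_g\;\ge\;\frac{(n-2)^2}{m^2}\sum_{1\le i<j\le m}\int_{\mathbb S^n_+}\left|\frac{\nabla_g d_i}{d_i}-\frac{\nabla_g d_j}{d_j}\right|^2u^2\,\mathrm dv_g .$$ -/

import Mathlib

open MeasureTheory Filter Topology
open scoped Manifold ContDiff Bundle

namespace MultipolarHardy

noncomputable section

/-- The Euclidean space `ℝⁿ⁺¹`. -/
abbrev Ambient (n : ℕ) : Type := EuclideanSpace ℝ (Fin (n + 1))

instance (n : ℕ) : Fact (Module.finrank ℝ (Ambient n) = n + 1) :=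
  ⟨by simp⟩

/-- The unit sphere `𝕊ⁿ ⊂ ℝⁿ⁺¹`, with Mathlib's smooth structure (modelled on `𝓡 n`). -/
abbrev UnitSphere (n : ℕ) : Type := Metric.sphere (0 : Ambient n) 1

/-- The differential at `x` of the inclusion `𝕊ⁿ → ℝⁿ⁺¹`. -/
def inclDeriv (n : ℕ) (x : UnitSphere n) : TangentSpace (𝓡 n) x →L[ℝ] Ambient n :=
  mvfderiv (𝓡 n) ((↑) : UnitSphere n → Ambient n) x

theorem inclDeriv_injective (n : ℕ) (x : UnitSphere n) :
    Function.Injective (inclDeriv n x) :=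
  injective_mvfderiv_subtypeVal_sphere x

/-- The bilinear form `(v, w) ↦ ⟨dι v, dι w⟩` on the tangent space at `x`, where `ι` is the
inclusion `𝕊ⁿ → ℝⁿ⁺¹`. -/
def inheritedInner (n : ℕ) (x : UnitSphere n) :
    TangentSpace (𝓡 n) x →L[ℝ] TangentSpace (𝓡 n) x →L[ℝ] ℝ :=
  let L : EuclideanSpace ℝ (Fin n) →L[ℝ] Ambient n := inclDeriv n x
  (innerSL ℝ (E := Ambient n) : Ambient n →L[ℝ] Ambient n →L[ℝ] ℝ).bilinearComp L L

theorem inheritedInner_apply (n : ℕ) (x : UnitSphere n) (v w : TangentSpace (𝓡 n) x) :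
    inheritedInner n x v w = inner ℝ (inclDeriv n x v) (inclDeriv n x w) :=
  rfl

/-- The Riemannian metric of `𝕊ⁿ` inherited from `ℝⁿ⁺¹`: the pull-back of the Euclidean inner
product under the differential of the inclusion. -/
def inheritedMetric (n : ℕ) :
    Bundle.RiemannianMetric (fun x : UnitSphere n => TangentSpace (𝓡 n) x) where
  inner x := inheritedInner n x
  symm x v w := by
    simp only [inheritedInner_apply, real_inner_comm]
  pos x v hv := by
    have h : inclDeriv n x v ≠ 0 := fun h0 =>
      hv (inclDeriv_injective n x (by rw [h0, map_zero]))
    simpa only [inheritedInner_apply] using real_inner_self_pos.2 h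
  continuousAt x := by
    have h : Continuous fun v : TangentSpace (𝓡 n) x =>
        inner ℝ (inclDeriv n x v) (inclDeriv n x v) :=
      (inclDeriv n x).continuous.inner (inclDeriv n x).continuous
    simpa only [inheritedInner_apply] using h.continuousAt
  isVonNBounded x := by
    let L : EuclideanSpace ℝ (Fin n) →L[ℝ] Ambient n := inclDeriv n x
    have hL : Function.Injective L := inclDeriv_injective n x
    obtain ⟨K, hK, hanti⟩ :=
      (L : EuclideanSpace ℝ (Fin n) →ₗ[ℝ] Ambient n).exists_antilipschitzWith
        (LinearMap.ker_eq_bot.2 hL)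
    change Bornology.IsVonNBounded ℝ
      {v : EuclideanSpace ℝ (Fin n) | inner ℝ (L v) (L v) < 1}
    refine (NormedSpace.isVonNBounded_ball ℝ (EuclideanSpace ℝ (Fin n)) (K + 1)).subset ?_
    intro v hv
    have hv1 : ‖L v‖ < 1 := by
      have h2 : inner ℝ (L v) (L v) < 1 := hv
      rw [real_inner_self_eq_norm_sq] at h2
      nlinarith [norm_nonneg (L v)]
    have hv2 : ‖v‖ ≤ K * ‖L v‖ := by
      simpa using hanti.le_mul_norm_sub v 0
    have hK0 : (0 : ℝ) ≤ K := K.2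
    have hv3 : ‖v‖ < K + 1 := by nlinarith
    simpa using hv3

instance (n : ℕ) : Bundle.RiemannianBundle (fun x : UnitSphere n => TangentSpace (𝓡 n) x) :=
  ⟨inheritedMetric n⟩

/-- The Riemannian norm of a tangent vector is its Euclidean norm in `ℝⁿ⁺¹`. -/
theorem norm_inclDeriv (n : ℕ) (x : UnitSphere n) (v : TangentSpace (𝓡 n) x) :
    ‖inclDeriv n x v‖ = ‖v‖ := by
  rw [norm_eq_sqrt_real_inner, norm_eq_sqrt_real_inner]
  rfl

instance (n : ℕ) (x : UnitSphere n) : FiniteDimensional ℝ (TangentSpace (𝓡 n) x) :=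
  inferInstanceAs (FiniteDimensional ℝ (EuclideanSpace ℝ (Fin n)))

instance (n : ℕ) (x : UnitSphere n) : CompleteSpace (TangentSpace (𝓡 n) x) :=
  FiniteDimensional.complete ℝ _

/-- The geodesic distance `d_g(x, y)` of `𝕊ⁿ`: the infimum of the lengths, with respect to the
inherited Riemannian metric, of the `C¹` paths on `𝕊ⁿ` from `x` to `y`. -/
def geodDist (n : ℕ) (x y : UnitSphere n) : ℝ :=
  (Manifold.riemannianEDist (𝓡 n) x y).toReal

/-- The canonical Riemannian volume `v_g` of `𝕊ⁿ`, i.e. its surface measure. -/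
def sphereVolume (n : ℕ) : Measure (UnitSphere n) :=
  (volume : Measure (Ambient n)).toSphere

/-- The Riemannian gradient: the tangent vector that represents the differential of `f` at `x`
with respect to the inherited metric. -/
def tangentGrad (n : ℕ) (f : UnitSphere n → ℝ) (x : UnitSphere n) : TangentSpace (𝓡 n) x :=
  (InnerProductSpace.toDual ℝ (TangentSpace (𝓡 n) x)).symm (mvfderiv (𝓡 n) f x)

/-- The Riemannian gradient `∇_g f(x)`, seen as a vector of `ℝⁿ⁺¹`. As the metric is inherited
from `ℝⁿ⁺¹`, its Riemannian norm is its Euclidean norm. -/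
def grad (n : ℕ) (f : UnitSphere n → ℝ) (x : UnitSphere n) : Ambient n :=
  inclDeriv n x (tangentGrad n f x)

/-- The north pole `(0, …, 0, 1)`. -/
def northPole (n : ℕ) : UnitSphere n :=
  ⟨EuclideanSpace.single (Fin.last n) 1, by simp⟩

/-- The open upper hemisphere. -/
def upperHemisphere (n : ℕ) : Set (UnitSphere n) :=
  {y | 0 < (y : Ambient n) (Fin.last n)}

/-- The restriction of `v_g` to the open upper hemisphere. -/
def hemisphereVolume (n : ℕ) : Measure (UnitSphere n) :=
  (sphereVolume n).restrict (upperHemisphere n)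

/-- `C₀^∞` of the open upper hemisphere; a function in it is extended by `0` to the sphere. (The
closed support is compact, the sphere being compact.) -/
def IsTestFunction (n : ℕ) (φ : UnitSphere n → ℝ) : Prop :=
  ContMDiff (𝓡 n) 𝓘(ℝ, ℝ) ∞ φ ∧ tsupport φ ⊆ upperHemisphere n

/-- `u` belongs to `H¹_g` of the open upper hemisphere, with gradient `V`. The space `H¹_g` is the
completion of `C₀^∞` for the norm `(‖u‖²_{L²} + ‖∇_g u‖²_{L²})^{1/2}`; it is realized here as the
closure of `{(φ, ∇_g φ)}` in `L² × L²`. -/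
def MemSobolev (n : ℕ) (u : UnitSphere n → ℝ) (V : UnitSphere n → Ambient n) : Prop :=
  MemLp u 2 (hemisphereVolume n) ∧ MemLp V 2 (hemisphereVolume n) ∧
    ∃ φ : ℕ → UnitSphere n → ℝ, (∀ k, IsTestFunction n (φ k)) ∧
      Tendsto (fun k => eLpNorm (φ k - u) 2 (hemisphereVolume n)) atTop (𝓝 0) ∧
      Tendsto (fun k => eLpNorm (grad n (φ k) - V) 2 (hemisphereVolume n)) atTop (𝓝 0)

/-- `|∇_g d_p / d_p - ∇_g d_q / d_q|²` at `y`, where `d_p = d_g(·, p)`. -/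
def bipolarPotential (n : ℕ) (p q y : UnitSphere n) : ℝ :=
  ‖(geodDist n y p)⁻¹ • grad n (fun z => geodDist n z p) y -
    (geodDist n y q)⁻¹ • grad n (fun z => geodDist n z q) y‖ ^ 2

/-- The constant `C(n, β)`. -/
def hardyConst (n : ℕ) (β : ℝ) : ℝ :=
  ((n : ℝ) - 1) * ((n : ℝ) - 2) *
    ((7 * Real.pi ^ 2 - 3 * (β + Real.pi / 2) ^ 2) /
      (2 * Real.pi ^ 2 * (Real.pi ^ 2 - (β + Real.pi / 2) ^ 2)))

end

end MultipolarHardy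

/-!
Write `Z_i = -∇d_i / d_i`. On the sphere
`div Z_i + (n - 2) |Z_i|² = (n - 1) (1 - d_i cot d_i) / d_i²`,
which the Mittag-Leffler expansion of the cotangent bounds by an increasing function of
`d_i < β + π / 2`. Expanding `|∇φ - (n - 2) φ ∑ a_i Z_i|² ≥ 0` for weights `a_i` of sum one,
integrating the cross terms by parts, and using
`∑ a_i |Z_i|² - |∑ a_i Z_i|² = ∑_{i < j} a_i a_j |Z_i - Z_j|²` gives the inequality, with the
weights `a_i a_j` in place of `1 / m²`.

The fields `Z_i` are singular at the poles. There they are multiplied by a cutoff which decreases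
towards the pole, so that its derivative enters the divergence with a favourable sign; Fatou's lemma
removes the cutoff, and then extends the inequality from test functions to their `H¹` closure.
-/

namespace MultipolarHardy

noncomputable section

open scoped InnerProductSpace

/-! ### A weighted variance identity -/

section InnerProduct

variable {E : Type*} [NormedAddCommGroup E] [InnerProductSpace ℝ E]

theorem norm_sub_inner_smul_sq {y : E} (hy : ‖y‖ = 1) (p : E) :
    ‖p - ⟪y, p⟫_ℝ • y‖ ^ 2 = ‖p‖ ^ 2 - ⟪y, p⟫_ℝ ^ 2 := by
  rw [norm_sub_sq_real, inner_smul_right, norm_smul, real_inner_comm y p, hy, mul_one,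
    Real.norm_eq_abs, sq_abs]
  ring

theorem hasFDerivAt_inner_right (p x : E) :
    HasFDerivAt (fun x : E => ⟪x, p⟫_ℝ) (innerSL ℝ p) x := by
  simp only [real_inner_comm p]
  exact (innerSL ℝ p).hasFDerivAt

variable {ι : Type*} [Fintype ι]

theorem sum_sum_mul_norm_sub_sq (a : ι → ℝ) (Y : ι → E) :
    ∑ i, ∑ j, a i * a j * ‖Y i - Y j‖ ^ 2 =
      2 * ((∑ i, a i) * ∑ i, a i * ‖Y i‖ ^ 2 - ‖∑ i, a i • Y i‖ ^ 2) := by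
  have expand : ∀ i j, a i * a j * ‖Y i - Y j‖ ^ 2 =
      a j * (a i * ‖Y i‖ ^ 2) + a i * (a j * ‖Y j‖ ^ 2) - 2 * ⟪a i • Y i, a j • Y j⟫_ℝ := by
    intro i j
    rw [norm_sub_sq_real, real_inner_smul_left, real_inner_smul_right]
    ring
  simp only [expand, Finset.sum_sub_distrib, Finset.sum_add_distrib, ← Finset.sum_mul,
    ← Finset.mul_sum, ← inner_sum, ← sum_inner, real_inner_self_eq_norm_sq]
  ring

variable [LinearOrder ι] [LocallyFiniteOrderTop ι]

theorem two_mul_sum_sum_Ioi_of_symm {f : ι → ι → ℝ} (hsymm : ∀ i j, f i j = f j i)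
    (hdiag : ∀ i, f i i = 0) : 2 * ∑ i, ∑ j ∈ Finset.Ioi i, f i j = ∑ i, ∑ j, f i j := by
  have : LocallyFiniteOrderBot ι :=
    LocallyFiniteOrderBot.ofIic ι (fun i => {j | j ≤ i}) fun i j => by simp
  calc 2 * ∑ i, ∑ j ∈ Finset.Ioi i, f i j = ∑ i, ∑ j ∈ Finset.Ioi i, (f j i + f i j) := by
        simp only [hsymm _, Finset.mul_sum, two_mul]
    _ = ∑ i, ∑ j ∈ {i}ᶜ, f j i := Finset.sum_sum_Ioi_add_eq_sum_sum_off_diag f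
    _ = ∑ i, ∑ j, f i j := by
        refine Finset.sum_congr rfl fun i _ => ?_
        rw [← Finset.sum_compl_add_sum {i}, Finset.sum_singleton, hdiag, add_zero]
        exact Finset.sum_congr rfl fun j _ => hsymm j i

theorem sum_sum_Ioi_mul_norm_sub_sq (a : ι → ℝ) (Y : ι → E) :
    ∑ i, ∑ j ∈ Finset.Ioi i, a i * a j * ‖Y i - Y j‖ ^ 2 =
      (∑ i, a i) * ∑ i, a i * ‖Y i‖ ^ 2 - ‖∑ i, a i • Y i‖ ^ 2 := by
  have h := two_mul_sum_sum_Ioi_of_symm (f := fun i j => a i * a j * ‖Y i - Y j‖ ^ 2)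
    (fun i j => by rw [norm_sub_rev, mul_comm (a i)]) (fun i => by simp)
  rw [sum_sum_mul_norm_sub_sq] at h
  linarith

theorem sq_mul_sum_sum_Ioi_norm_sub_sq_le {a : ι → ℝ} (ha : ∑ i, a i = 1) (c : ℝ) (v : E)
    (Y : ι → E) :
    c ^ 2 * ∑ i, ∑ j ∈ Finset.Ioi i, a i * a j * ‖Y i - Y j‖ ^ 2 ≤
      ‖v‖ ^ 2 - ∑ i, a i * (2 * c * ⟪v, Y i⟫_ℝ - c ^ 2 * ‖Y i‖ ^ 2) := by
  have hsq := sq_nonneg ‖v - c • ∑ i, a i • Y i‖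
  have hinner : ⟪v, ∑ i, a i • Y i⟫_ℝ = ∑ i, a i * ⟪v, Y i⟫_ℝ := by
    simp only [inner_sum, real_inner_smul_right]
  have hsum : ∑ i, a i * (2 * c * ⟪v, Y i⟫_ℝ - c ^ 2 * ‖Y i‖ ^ 2) =
      2 * c * ∑ i, a i * ⟪v, Y i⟫_ℝ - c ^ 2 * ∑ i, a i * ‖Y i‖ ^ 2 := by
    rw [Finset.mul_sum, Finset.mul_sum, ← Finset.sum_sub_distrib]
    exact Finset.sum_congr rfl fun i _ => by ring
  rw [norm_sub_sq_real, real_inner_smul_right, hinner, norm_smul, mul_pow, Real.norm_eq_abs,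
    sq_abs] at hsq
  rw [sum_sum_Ioi_mul_norm_sub_sq, ha, hsum]
  linarith

end InnerProduct

/-! ### Gradients on the sphere -/

section Sphere

variable {n : ℕ}

theorem norm_coe_sphere (y : UnitSphere n) : ‖(y : Ambient n)‖ = 1 := by simp

theorem coe_sphere_ne_zero (y : UnitSphere n) : (y : Ambient n) ≠ 0 :=
  norm_ne_zero_iff.1 (by simp)

theorem continuous_inner_coe (p : UnitSphere n) :
    Continuous fun y : UnitSphere n => ⟪(y : Ambient n), p⟫_ℝ :=
  continuous_subtype_val.inner continuous_const

theorem abs_inner_coe_le_one (y p : UnitSphere n) : |⟪(y : Ambient n), p⟫_ℝ| ≤ 1 := by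
  simpa using abs_real_inner_le_norm (y : Ambient n) (p : Ambient n)

theorem inner_coe_lt_one {y p : UnitSphere n} (h : y ≠ p) : ⟪(y : Ambient n), p⟫_ℝ < 1 :=
  (inner_lt_one_iff_real_of_norm_eq_one (norm_coe_sphere y) (norm_coe_sphere p)).2
    (Subtype.coe_injective.ne h)

theorem norm_coe_sub_inner_smul_sq (y p : UnitSphere n) :
    ‖(p : Ambient n) - ⟪(y : Ambient n), p⟫_ℝ • (y : Ambient n)‖ ^ 2 =
      1 - ⟪(y : Ambient n), p⟫_ℝ ^ 2 := by
  rw [norm_sub_inner_smul_sq (norm_coe_sphere y), norm_coe_sphere, one_pow]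

/-- The radial projection `x ↦ x / ‖x‖` of `ℝⁿ⁺¹ ∖ {0}` onto `𝕊ⁿ`; its value at `0` is arbitrary.
Composition with it extends functions on the sphere to functions that are constant along rays. -/
def radialProj (n : ℕ) (x : Ambient n) : UnitSphere n :=
  if h : x = 0 then northPole n else ⟨‖x‖⁻¹ • x, by simp [norm_smul, h]⟩

theorem coe_radialProj {x : Ambient n} (hx : x ≠ 0) :
    (radialProj n x : Ambient n) = ‖x‖⁻¹ • x := by
  simp [radialProj, hx]

theorem radialProj_smul_coe (y : UnitSphere n) {r : ℝ} (hr : 0 < r) :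
    radialProj n (r • (y : Ambient n)) = y := by
  apply Subtype.ext
  rw [coe_radialProj (smul_ne_zero hr.ne' (coe_sphere_ne_zero y)), norm_smul, smul_smul]
  simp [abs_of_pos hr, hr.ne']

theorem radialProj_coe (y : UnitSphere n) : radialProj n y = y := by
  simpa only [one_smul] using radialProj_smul_coe y one_pos

theorem radialProj_smul {r : ℝ} (hr : 0 < r) (x : Ambient n) :
    radialProj n (r • x) = radialProj n x := by
  rcases eq_or_ne x 0 with rfl | hx
  · rw [smul_zero]
  · have : r • x = (r * ‖x‖) • (radialProj n x : Ambient n) := by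
      rw [coe_radialProj hx, smul_smul, mul_assoc, mul_inv_cancel₀ (norm_ne_zero_iff.2 hx),
        mul_one]
    rw [this, radialProj_smul_coe _ (mul_pos hr (norm_pos_iff.2 hx))]

theorem contMDiffAt_radialProj {k : ℕ∞ω} {x : Ambient n} (hx : x ≠ 0) :
    ContMDiffAt 𝓘(ℝ, Ambient n) (𝓡 n) k (radialProj n) x := by
  let U : TopologicalSpace.Opens (Ambient n) := ⟨{0}ᶜ, isOpen_compl_singleton⟩
  have mem_sphere : ∀ z : U, ‖(z : Ambient n)‖⁻¹ • (z : Ambient n) ∈ Metric.sphere 0 1 :=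
    fun z => by simp [norm_smul, show (z : Ambient n) ≠ 0 from z.2]
  have smooth : ContMDiff 𝓘(ℝ, Ambient n) 𝓘(ℝ, Ambient n) k
      (fun z : U => ‖(z : Ambient n)‖⁻¹ • (z : Ambient n)) := fun z =>
    have hz : (z : Ambient n) ≠ 0 := z.2
    (((contDiffAt_norm ℝ hz).inv (norm_ne_zero_iff.2 hz)).smul
      contDiffAt_id).contMDiffAt.comp z (contMDiff_subtype_val z)
  have eq_radialProj : Set.codRestrict (fun z : U => ‖(z : Ambient n)‖⁻¹ • (z : Ambient n))
      (Metric.sphere 0 1) mem_sphere = fun z : U => radialProj n z :=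
    funext fun z => Subtype.ext (coe_radialProj z.2).symm
  have smooth_U := smooth.codRestrict_sphere (n := n) mem_sphere ⟨x, hx⟩
  rw [eq_radialProj] at smooth_U
  exact contMDiffAt_subtype_iff.1 smooth_U

theorem contDiffAt_comp_radialProj {k : ℕ∞ω} {f : UnitSphere n → ℝ}
    (hf : ContMDiff (𝓡 n) 𝓘(ℝ, ℝ) k f) {x : Ambient n} (hx : x ≠ 0) :
    ContDiffAt ℝ k (f ∘ radialProj n) x :=
  (hf.contMDiffAt.comp x (contMDiffAt_radialProj hx)).contDiffAt

theorem fderiv_comp_radialProj_self (f : UnitSphere n → ℝ) (y : UnitSphere n) :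
    fderiv ℝ (f ∘ radialProj n) y y = 0 := by
  by_cases h : DifferentiableAt ℝ (f ∘ radialProj n) (y : Ambient n)
  · refine HasDerivAt.unique (h.hasFDerivAt.hasLineDerivAt (y : Ambient n))
      ((hasDerivAt_const (0 : ℝ) (f y)).congr_of_eventuallyEq ?_)
    filter_upwards [Ioi_mem_nhds (show (-1 : ℝ) < 0 by norm_num)] with t ht
    have hray : (y : Ambient n) + t • (y : Ambient n) = (1 + t) • (y : Ambient n) := by
      rw [add_smul, one_smul]
    rw [hray, Function.comp_apply, radialProj_smul_coe y (by linarith [Set.mem_Ioi.1 ht])]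
  · rw [fderiv_zero_of_not_differentiableAt h, zero_apply]

theorem fderiv_comp_radialProj_smul (f : UnitSphere n → ℝ) (x : Ambient n) {r : ℝ}
    (hr : 0 < r) :
    fderiv ℝ (f ∘ radialProj n) (r • x) = r⁻¹ • fderiv ℝ (f ∘ radialProj n) x := by
  have hcomp : (fun z => (f ∘ radialProj n) (r • z)) = f ∘ radialProj n := by
    funext z
    rw [Function.comp_apply, Function.comp_apply, radialProj_smul hr]
  have h := fderiv_comp_smul (𝕜 := ℝ) (f := f ∘ radialProj n) (x := x) r
  rw [hcomp] at h
  rw [h, inv_smul_smul₀ hr.ne']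

theorem continuous_fderiv_comp_radialProj {f : UnitSphere n → ℝ}
    (hf : ContMDiff (𝓡 n) 𝓘(ℝ, ℝ) 1 f) :
    Continuous fun y : UnitSphere n => fderiv ℝ (f ∘ radialProj n) y :=
  continuous_iff_continuousAt.2 fun y =>
    ((contDiffAt_comp_radialProj hf (coe_sphere_ne_zero y)).continuousAt_fderiv
      one_ne_zero).comp (f := ((↑) : UnitSphere n → Ambient n)) continuous_subtype_val.continuousAt

theorem inner_inclDeriv (y : UnitSphere n) (w : TangentSpace (𝓡 n) y) :
    ⟪(y : Ambient n), inclDeriv n y w⟫_ℝ = 0 := by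
  have hmem : inclDeriv n y w ∈ (inclDeriv n y).range := ⟨w, rfl⟩
  rw [inclDeriv, range_mvfderiv_subtypeVal (n := n) y] at hmem
  exact Submodule.mem_orthogonal_singleton_iff_inner_right.1 hmem

theorem exists_inclDeriv_eq (y : UnitSphere n) {v : Ambient n} (hv : ⟪(y : Ambient n), v⟫_ℝ = 0) :
    ∃ w, inclDeriv n y w = v := by
  have hmem : v ∈ (ℝ ∙ (y : Ambient n))ᗮ :=
    Submodule.mem_orthogonal_singleton_iff_inner_right.2 hv
  rwa [← range_mvfderiv_subtypeVal (n := n) y] at hmem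

theorem inner_inclDeriv_inclDeriv (y : UnitSphere n) (v w : TangentSpace (𝓡 n) y) :
    ⟪inclDeriv n y v, inclDeriv n y w⟫_ℝ = ⟪v, w⟫_ℝ := rfl

theorem inner_coe_grad (f : UnitSphere n → ℝ) (y : UnitSphere n) :
    ⟪(y : Ambient n), grad n f y⟫_ℝ = 0 := inner_inclDeriv y _

theorem inner_grad_inclDeriv (f : UnitSphere n → ℝ) (y : UnitSphere n)
    (w : TangentSpace (𝓡 n) y) :
    ⟪grad n f y, inclDeriv n y w⟫_ℝ = mvfderiv (𝓡 n) f y w := by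
  rw [grad, inner_inclDeriv_inclDeriv, tangentGrad, InnerProductSpace.toDual_symm_apply]

theorem hasMFDerivAt_coe_sphere (y : UnitSphere n) :
    HasMFDerivAt (𝓡 n) 𝓘(ℝ, Ambient n) ((↑) : UnitSphere n → Ambient n) y
      (mfderiv (𝓡 n) 𝓘(ℝ, Ambient n) ((↑) : UnitSphere n → Ambient n) y) :=
  ((contMDiff_coe_sphere (m := 1) y).mdifferentiableAt one_ne_zero).hasMFDerivAt

section AmbientExtension

variable {f : UnitSphere n → ℝ} {y : UnitSphere n} {F : Ambient n → ℝ}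

theorem mvfderiv_apply_of_hasFDerivAt {F' : Ambient n →L[ℝ] ℝ}
    (hF : HasFDerivAt F F' (y : Ambient n)) (hf : f =ᶠ[𝓝 y] fun z => F z)
    (w : TangentSpace (𝓡 n) y) :
    mvfderiv (𝓡 n) f y w = F' (inclDeriv n y w) := by
  rw [mvfderiv, ((hF.hasMFDerivAt.comp y (hasMFDerivAt_coe_sphere y)).congr_of_eventuallyEq
    hf).mfderiv]
  rfl

theorem inner_grad_of_hasFDerivAt {F' : Ambient n →L[ℝ] ℝ}
    (hF : HasFDerivAt F F' (y : Ambient n)) (hf : f =ᶠ[𝓝 y] fun z => F z) (v : Ambient n) :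
    ⟪grad n f y, v⟫_ℝ = F' (v - ⟪(y : Ambient n), v⟫_ℝ • (y : Ambient n)) := by
  obtain ⟨w, hw⟩ := exists_inclDeriv_eq y (v := v - ⟪(y : Ambient n), v⟫_ℝ • (y : Ambient n))
    (by simp [inner_sub_right, inner_smul_right])
  rw [← hw, ← mvfderiv_apply_of_hasFDerivAt hF hf, ← inner_grad_inclDeriv, hw, inner_sub_right,
    inner_smul_right, real_inner_comm (y : Ambient n) (grad n f y), inner_coe_grad, mul_zero,
    sub_zero]

theorem grad_eq_of_hasFDerivAt {a : Ambient n} (hF : HasFDerivAt F (innerSL ℝ a) (y : Ambient n))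
    (hf : f =ᶠ[𝓝 y] fun z => F z) :
    grad n f y = a - ⟪(y : Ambient n), a⟫_ℝ • (y : Ambient n) := by
  refine ext_inner_right ℝ fun v => ?_
  rw [inner_grad_of_hasFDerivAt hF hf, innerSL_apply_apply, inner_sub_left, inner_sub_right,
    real_inner_smul_left, inner_smul_right, real_inner_comm a]
  ring

end AmbientExtension

section ContMDiff

variable {f : UnitSphere n → ℝ}

theorem inner_grad_eq_fderiv (hf : ContMDiff (𝓡 n) 𝓘(ℝ, ℝ) 1 f) (y : UnitSphere n)
    (v : Ambient n) : ⟪grad n f y, v⟫_ℝ = fderiv ℝ (f ∘ radialProj n) y v := by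
  have hdiff := (contDiffAt_comp_radialProj hf (coe_sphere_ne_zero y)).differentiableAt one_ne_zero
  rw [inner_grad_of_hasFDerivAt hdiff.hasFDerivAt
    (Eventually.of_forall fun z => (congrArg f (radialProj_coe z)).symm), map_sub, map_smul,
    fderiv_comp_radialProj_self, smul_zero, sub_zero]

theorem continuous_grad (hf : ContMDiff (𝓡 n) 𝓘(ℝ, ℝ) 1 f) : Continuous (grad n f) := by
  have hgrad : grad n f = fun y : UnitSphere n =>
      (InnerProductSpace.toDual ℝ (Ambient n)).symm (fderiv ℝ (f ∘ radialProj n) y) := by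
    funext y
    refine ext_inner_right ℝ fun v => ?_
    rw [inner_grad_eq_fderiv hf, InnerProductSpace.toDual_symm_apply]
  rw [hgrad]
  exact (LinearIsometryEquiv.continuous _).comp (continuous_fderiv_comp_radialProj hf)

end ContMDiff

end Sphere

/-! ### The geodesic distance -/

section GeodesicDistance

variable {n : ℕ} {y p : UnitSphere n}

theorem hasDerivWithinAt_coe_sphere_comp {γ : ℝ → UnitSphere n} {s : Set ℝ} {t : ℝ}
    (h : MDifferentiableWithinAt 𝓘(ℝ, ℝ) (𝓡 n) γ s t) :
    HasDerivWithinAt (fun t => (γ t : Ambient n))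
      (inclDeriv n (γ t) (mfderivWithin 𝓘(ℝ, ℝ) (𝓡 n) γ s t (1 : ℝ))) s t :=
  HasFDerivWithinAt.hasDerivWithinAt (F := Ambient n) (f := fun t => (γ t : Ambient n))
    (hasMFDerivWithinAt_iff_hasFDerivWithinAt.1
      ((hasMFDerivAt_coe_sphere (γ t)).comp_hasMFDerivWithinAt t h.hasMFDerivWithinAt))

theorem abs_mul_inner_coe_lt_one {c : ℝ} (hc : 0 ≤ c) (hc1 : c < 1) (y p : UnitSphere n) :
    |c * ⟪(y : Ambient n), p⟫_ℝ| < 1 := by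
  rw [abs_mul, abs_of_nonneg hc]
  exact (mul_le_of_le_one_right hc (abs_inner_coe_le_one y p)).trans_lt hc1

theorem abs_inner_le_norm_mul_sqrt (y p : UnitSphere n) {v : Ambient n}
    (hv : ⟪(y : Ambient n), v⟫_ℝ = 0) :
    |⟪v, (p : Ambient n)⟫_ℝ| ≤ ‖v‖ * √(1 - ⟪(y : Ambient n), p⟫_ℝ ^ 2) := by
  have htangent : ⟪v, (p : Ambient n)⟫_ℝ =
      ⟪v, (p : Ambient n) - ⟪(y : Ambient n), p⟫_ℝ • (y : Ambient n)⟫_ℝ := by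
    rw [inner_sub_right, real_inner_smul_right, real_inner_comm (y : Ambient n) v, hv, mul_zero,
      sub_zero]
  rw [htangent, ← norm_coe_sub_inner_smul_sq, Real.sqrt_sq (norm_nonneg _)]
  exact abs_real_inner_le_norm _ _

/-- The factor `c < 1` keeps the argument of `arccos` away from its singularities at `±1`; the
gradient of `arccos (c ⟪·, p⟫)` still has norm at most one. -/
theorem abs_deriv_arccos_mul_inner_le_norm {c : ℝ} (hc : 0 ≤ c) (hc1 : c < 1)
    (y p : UnitSphere n) {v : Ambient n} (hv : ⟪(y : Ambient n), v⟫_ℝ = 0) :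
    |-(1 / √(1 - (c * ⟪(y : Ambient n), p⟫_ℝ) ^ 2)) * (c * ⟪v, (p : Ambient n)⟫_ℝ)| ≤ ‖v‖ := by
  have hle := (sq_le_one_iff_abs_le_one _).2 (abs_inner_coe_le_one y p)
  have hlt := (sq_lt_one_iff_abs_lt_one _).2 (abs_mul_inner_coe_lt_one hc hc1 y p)
  have hv' := abs_inner_le_norm_mul_sqrt y p hv
  set s : ℝ := ⟪(y : Ambient n), p⟫_ℝ
  have hsqrt : c * √(1 - s ^ 2) ≤ √(1 - (c * s) ^ 2) := by
    apply Real.le_sqrt_of_sq_le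
    rw [mul_pow, Real.sq_sqrt (by linarith)]
    nlinarith
  have hpos : 0 < √(1 - (c * s) ^ 2) := Real.sqrt_pos.2 (by linarith)
  rw [abs_mul, abs_neg, abs_mul, abs_of_nonneg hc, abs_of_pos (one_div_pos.2 hpos), one_div,
    inv_mul_le_iff₀ hpos]
  calc c * |⟪v, (p : Ambient n)⟫_ℝ| ≤ c * (‖v‖ * √(1 - s ^ 2)) := by gcongr
    _ = (c * √(1 - s ^ 2)) * ‖v‖ := by ring
    _ ≤ √(1 - (c * s) ^ 2) * ‖v‖ := by gcongr

theorem arccos_mul_inner_sub_le_pathELength {c : ℝ} (hc : 0 ≤ c) (hc1 : c < 1)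
    (p : UnitSphere n) {γ : ℝ → UnitSphere n}
    (hγ : ContMDiffOn 𝓘(ℝ, ℝ) (𝓡 n) 1 γ (Set.Icc 0 1)) :
    ENNReal.ofReal (Real.arccos (c * ⟪(γ 0 : Ambient n), p⟫_ℝ) -
      Real.arccos (c * ⟪(γ 1 : Ambient n), p⟫_ℝ)) ≤ Manifold.pathELength (𝓡 n) γ 0 1 := by
  have hlt := fun t => abs_lt.1 (abs_mul_inner_coe_lt_one hc hc1 (γ t) p)
  have hcoe : ContDiffOn ℝ 1 (fun t => (γ t : Ambient n)) (Set.Icc 0 1) :=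
    contMDiffOn_iff_contDiffOn.1 ((contMDiff_coe_sphere (m := 1)).comp_contMDiffOn hγ)
  have harccos : ContDiffOn ℝ 1 (fun t => Real.arccos (c * ⟪(γ t : Ambient n), p⟫_ℝ))
      (Set.Icc 0 1) := fun t ht =>
    ContDiffAt.comp_contDiffWithinAt (g := Real.arccos) t
      (Real.contDiffAt_arccos (hlt t).1.ne' (hlt t).2.ne)
      (contDiffWithinAt_const.mul ((hcoe t ht).inner ℝ contDiffWithinAt_const))
  rw [Manifold.pathELength_eq_lintegral_mfderivWithin_Icc]
  calc _ ≤ ‖Real.arccos (c * ⟪(γ 1 : Ambient n), p⟫_ℝ) -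
          Real.arccos (c * ⟪(γ 0 : Ambient n), p⟫_ℝ)‖ₑ := by
        rw [enorm_sub_rev, Real.enorm_eq_ofReal_abs]
        exact ENNReal.ofReal_le_ofReal (le_abs_self _)
    _ ≤ ∫⁻ t in Set.Icc 0 1, ‖derivWithin (fun t => Real.arccos (c * ⟪(γ t : Ambient n), p⟫_ℝ))
          (Set.Icc 0 1) t‖ₑ :=
        enorm_sub_le_lintegral_derivWithin_Icc_of_contDiffOn_Icc harccos zero_le_one
    _ ≤ _ := by
        refine setLIntegral_mono' measurableSet_Icc fun t ht => ?_
        have hinner := ((hasDerivWithinAt_coe_sphere_comp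
          ((hγ t ht).mdifferentiableWithinAt one_ne_zero)).inner ℝ
            (hasDerivWithinAt_const t _ (p : Ambient n))).const_mul c
        have hderiv : HasDerivWithinAt (fun t => Real.arccos (c * ⟪(γ t : Ambient n), p⟫_ℝ)) _
            (Set.Icc 0 1) t :=
          HasDerivAt.comp_hasDerivWithinAt (h₂ := Real.arccos) t
            (Real.hasDerivAt_arccos (hlt t).1.ne' (hlt t).2.ne) hinner
        rw [hderiv.derivWithin (uniqueDiffOn_Icc zero_lt_one t ht), enorm_le_iff_norm_le,
          ← norm_inclDeriv, inner_zero_right, zero_add]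
        exact abs_deriv_arccos_mul_inner_le_norm hc hc1 (γ t) p (inner_inclDeriv (γ t) _)

theorem arccos_inner_le_riemannianEDist (y p : UnitSphere n) :
    ENNReal.ofReal (Real.arccos ⟪(y : Ambient n), p⟫_ℝ) ≤ Manifold.riemannianEDist (𝓡 n) y p := by
  refine le_of_forall_gt fun r hr => ?_
  obtain ⟨γ, h0, h1, hγ, hlen⟩ := Manifold.exists_lt_of_riemannianEDist_lt hr
  refine lt_of_le_of_lt ?_ hlen
  have hcont : Continuous fun c : ℝ => ENNReal.ofReal
      (Real.arccos (c * ⟪(y : Ambient n), p⟫_ℝ) - Real.arccos (c * ⟪(p : Ambient n), p⟫_ℝ)) :=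
    ENNReal.continuous_ofReal.comp (by fun_prop)
  have hlim := (hcont.tendsto 1).mono_left (nhdsWithin_le_nhds (s := Set.Iio 1))
  simp only [one_mul, real_inner_self_eq_norm_sq, norm_coe_sphere, one_pow, mul_one,
    Real.arccos_one, sub_zero] at hlim
  refine le_of_tendsto hlim ?_
  filter_upwards [Ioo_mem_nhdsLT (show (0 : ℝ) < 1 from one_pos)] with c hc
  simpa only [h0, h1, real_inner_self_eq_norm_sq, norm_coe_sphere, one_pow, mul_one] using
    arccos_mul_inner_sub_le_pathELength hc.1.le hc.2 p hγ

theorem norm_cos_smul_add_sin_smul {w : Ambient n} (hw : ‖w‖ = 1)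
    (hyw : ⟪(y : Ambient n), w⟫_ℝ = 0) (t : ℝ) :
    ‖Real.cos t • (y : Ambient n) + Real.sin t • w‖ = 1 := by
  have hsq := norm_add_sq_eq_norm_sq_add_norm_sq_real
    (show ⟪Real.cos t • (y : Ambient n), Real.sin t • w⟫_ℝ = 0 by
      rw [real_inner_smul_left, real_inner_smul_right, hyw, mul_zero, mul_zero])
  rw [norm_smul, norm_smul, norm_coe_sphere, hw, mul_one, mul_one, Real.norm_eq_abs,
    Real.norm_eq_abs, ← sq, ← sq, ← sq, sq_abs, sq_abs, Real.cos_sq_add_sin_sq] at hsq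
  exact (pow_eq_one_iff_of_nonneg (norm_nonneg _) two_ne_zero).1 hsq

/-- The unit speed great circle through `y` with unit initial velocity `w ⟂ y`. -/
def greatCircle {w : Ambient n} (hw : ‖w‖ = 1) (hyw : ⟪(y : Ambient n), w⟫_ℝ = 0) :
    ℝ → UnitSphere n :=
  Set.codRestrict (fun t => Real.cos t • (y : Ambient n) + Real.sin t • w) _ fun t =>
    mem_sphere_zero_iff_norm.2 (norm_cos_smul_add_sin_smul hw hyw t)

section GreatCircle

variable {w : Ambient n} (hw : ‖w‖ = 1) (hyw : ⟪(y : Ambient n), w⟫_ℝ = 0)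

theorem contMDiff_greatCircle : ContMDiff 𝓘(ℝ, ℝ) (𝓡 n) 1 (greatCircle hw hyw) :=
  ((Real.contDiff_cos.smul contDiff_const).add
    (Real.contDiff_sin.smul contDiff_const)).contMDiff.codRestrict_sphere (n := n) _

theorem enorm_mfderiv_greatCircle (t : ℝ) :
    ‖mfderiv 𝓘(ℝ, ℝ) (𝓡 n) (greatCircle hw hyw) t (1 : ℝ)‖ₑ = 1 := by
  have hderiv : HasDerivAt (fun t => (greatCircle hw hyw t : Ambient n))
      (-Real.sin t • (y : Ambient n) + Real.cos t • w) t :=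
    ((Real.hasDerivAt_cos t).smul_const _).add ((Real.hasDerivAt_sin t).smul_const _)
  have hderiv' := hasDerivWithinAt_coe_sphere_comp
    ((contMDiff_greatCircle hw hyw t).mdifferentiableAt one_ne_zero).mdifferentiableWithinAt
      (s := Set.univ)
  rw [mfderivWithin_univ, hasDerivWithinAt_univ] at hderiv'
  have hnorm := norm_cos_smul_add_sin_smul hw hyw (t + Real.pi / 2)
  rw [Real.cos_add_pi_div_two, Real.sin_add_pi_div_two] at hnorm
  rw [← ofReal_norm, ← norm_inclDeriv, hderiv'.unique hderiv, hnorm, ENNReal.ofReal_one]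

theorem riemannianEDist_greatCircle_le {r : ℝ} (hr : 0 ≤ r) :
    Manifold.riemannianEDist (𝓡 n) y (greatCircle hw hyw r) ≤ ENNReal.ofReal r := by
  have hzero : greatCircle hw hyw 0 = y := Subtype.ext (by simp [greatCircle])
  calc Manifold.riemannianEDist (𝓡 n) y (greatCircle hw hyw r)
      ≤ Manifold.pathELength (𝓡 n) (greatCircle hw hyw) 0 r :=
        Manifold.riemannianEDist_le_pathELength (contMDiff_greatCircle hw hyw).contMDiffOn hzero
          rfl hr
    _ = ∫⁻ _ in Set.Icc 0 r, 1 := by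
        rw [Manifold.pathELength_eq_lintegral_mfderiv_Icc]
        exact lintegral_congr fun t => enorm_mfderiv_greatCircle hw hyw t
    _ = ENNReal.ofReal r := by simp

end GreatCircle

theorem sqrt_one_sub_inner_sq_pos (h : -1 < ⟪(y : Ambient n), p⟫_ℝ)
    (h1 : ⟪(y : Ambient n), p⟫_ℝ < 1) : 0 < √(1 - ⟪(y : Ambient n), p⟫_ℝ ^ 2) :=
  Real.sqrt_pos.2 (by nlinarith)

theorem riemannianEDist_le_arccos_inner (h : -1 < ⟪(y : Ambient n), p⟫_ℝ) :
    Manifold.riemannianEDist (𝓡 n) y p ≤ ENNReal.ofReal (Real.arccos ⟪(y : Ambient n), p⟫_ℝ) := by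
  rcases eq_or_ne y p with rfl | hne
  · rw [Manifold.riemannianEDist_self]
    exact zero_le
  have h1 := inner_coe_lt_one hne
  have hpos := sqrt_one_sub_inner_sq_pos h h1
  have hnorm : ‖(p : Ambient n) - ⟪(y : Ambient n), p⟫_ℝ • (y : Ambient n)‖ =
      √(1 - ⟪(y : Ambient n), p⟫_ℝ ^ 2) := by
    rw [← norm_coe_sub_inner_smul_sq, Real.sqrt_sq (norm_nonneg _)]
  set s : ℝ := ⟪(y : Ambient n), p⟫_ℝ with hs
  have hw : ‖(√(1 - s ^ 2))⁻¹ • ((p : Ambient n) - s • (y : Ambient n))‖ = 1 := by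
    rw [norm_smul, norm_inv, Real.norm_of_nonneg hpos.le, hnorm, inv_mul_cancel₀ hpos.ne']
  have hyw : ⟪(y : Ambient n), (√(1 - s ^ 2))⁻¹ • ((p : Ambient n) - s • (y : Ambient n))⟫_ℝ
      = 0 := by
    rw [inner_smul_right, inner_sub_right, inner_smul_right, real_inner_self_eq_norm_sq,
      norm_coe_sphere, ← hs]
    ring
  have hend : greatCircle hw hyw (Real.arccos s) = p := by
    apply Subtype.ext
    rw [greatCircle, Set.val_codRestrict_apply, Real.cos_arccos h.le h1.le, Real.sin_arccos,
      smul_inv_smul₀ hpos.ne', add_sub_cancel]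
  simpa only [hend] using riemannianEDist_greatCircle_le hw hyw (Real.arccos_nonneg s)

theorem geodDist_eq_arccos (h : -1 < ⟪(y : Ambient n), p⟫_ℝ) :
    geodDist n y p = Real.arccos ⟪(y : Ambient n), p⟫_ℝ := by
  rw [geodDist, le_antisymm (riemannianEDist_le_arccos_inner h)
    (arccos_inner_le_riemannianEDist y p), ENNReal.toReal_ofReal (Real.arccos_nonneg _)]

theorem grad_geodDist (h : -1 < ⟪(y : Ambient n), p⟫_ℝ) (h1 : ⟪(y : Ambient n), p⟫_ℝ < 1) :
    grad n (fun z => geodDist n z p) y = -(√(1 - ⟪(y : Ambient n), p⟫_ℝ ^ 2))⁻¹ •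
      ((p : Ambient n) - ⟪(y : Ambient n), p⟫_ℝ • (y : Ambient n)) := by
  have harccos : HasFDerivAt (fun x : Ambient n => Real.arccos ⟪x, p⟫_ℝ)
      (innerSL ℝ (-(√(1 - ⟪(y : Ambient n), p⟫_ℝ ^ 2))⁻¹ • (p : Ambient n))) (y : Ambient n) := by
    rw [map_smul, ← one_div]
    exact HasDerivAt.comp_hasFDerivAt (h₂ := Real.arccos) (y : Ambient n)
      (Real.hasDerivAt_arccos h.ne' h1.ne) (hasFDerivAt_inner_right (p : Ambient n) y)
  rw [grad_eq_of_hasFDerivAt harccos, inner_smul_right, smul_sub, smul_smul]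
  filter_upwards [(continuous_inner_coe p).continuousAt.eventually (Ioi_mem_nhds h)] with z hz
  exact geodDist_eq_arccos hz

end GeodesicDistance

section Hemisphere

variable {n : ℕ} {y p : UnitSphere n}

theorem inner_northPole (y : UnitSphere n) :
    ⟪(northPole n : Ambient n), y⟫_ℝ = (y : Ambient n) (Fin.last n) := by
  simp [northPole, EuclideanSpace.inner_single_left]

theorem arccos_inner_eq_angle (y p : UnitSphere n) :
    Real.arccos ⟪(y : Ambient n), p⟫_ℝ =
      InnerProductGeometry.angle (y : Ambient n) (p : Ambient n) := by
  simp [InnerProductGeometry.angle]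

theorem arccos_inner_northPole_lt (hy : y ∈ upperHemisphere n) :
    Real.arccos ⟪(northPole n : Ambient n), y⟫_ℝ < Real.pi / 2 := by
  rw [Real.arccos_lt_pi_div_two, inner_northPole]
  exact hy

theorem geodDist_northPole (hy : y ∈ upperHemisphere n) :
    geodDist n (northPole n) y = Real.arccos ⟪(northPole n : Ambient n), y⟫_ℝ := by
  refine geodDist_eq_arccos ?_
  rw [inner_northPole]
  exact neg_one_lt_zero.trans hy

theorem arccos_inner_lt_of_mem_upperHemisphere (hy : y ∈ upperHemisphere n) :
    Real.arccos ⟪(y : Ambient n), p⟫_ℝ <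
      Real.arccos ⟪(northPole n : Ambient n), p⟫_ℝ + Real.pi / 2 := by
  have hlt := arccos_inner_northPole_lt hy
  have htriangle := InnerProductGeometry.angle_le_angle_add_angle (y : Ambient n) (northPole n)
    (p : Ambient n)
  rw [InnerProductGeometry.angle_comm (y : Ambient n) (northPole n)] at htriangle
  rw [arccos_inner_eq_angle] at hlt ⊢
  rw [arccos_inner_eq_angle]
  linarith

theorem neg_one_lt_inner_of_mem_upperHemisphere (hy : y ∈ upperHemisphere n)
    (hp : p ∈ upperHemisphere n) : -1 < ⟪(y : Ambient n), p⟫_ℝ := by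
  rw [← Real.arccos_lt_pi]
  linarith [arccos_inner_lt_of_mem_upperHemisphere (p := p) hy, arccos_inner_northPole_lt hp]

end Hemisphere

/-! ### Integration by parts on the sphere -/

section PolarCoordinates

variable {E : Type*} [NormedAddCommGroup E] [NormedSpace ℝ E] [FiniteDimensional ℝ E]
  [MeasurableSpace E] [BorelSpace E] (μ : Measure E) [μ.IsAddHaarMeasure]

theorem integral_volumeIoiPow (k : ℕ) (b : ℝ → ℝ) :
    ∫ r, b r ∂(Measure.volumeIoiPow k) = ∫ r in Set.Ioi (0 : ℝ), r ^ k * b r := by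
  simp only [Measure.volumeIoiPow, ENNReal.ofReal]
  rw [integral_withDensity_eq_integral_smul (measurable_subtype_coe.pow_const _).real_toNNReal,
    integral_subtype_comap measurableSet_Ioi fun r : ℝ => Real.toNNReal (r ^ k) • b r]
  refine setIntegral_congr_fun measurableSet_Ioi fun r hr => ?_
  rw [NNReal.smul_def, Real.coe_toNNReal _ (pow_nonneg (Set.mem_Ioi.1 hr).le _), smul_eq_mul]

theorem integral_eq_mul_of_polar [Nontrivial E] {G : E → ℝ} {a : Metric.sphere (0 : E) 1 → ℝ}
    {b : ℝ → ℝ}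
    (hG : ∀ (y : Metric.sphere (0 : E) 1) (r : ℝ), 0 < r → G (r • (y : E)) = a y * b r) :
    ∫ x, G x ∂μ = (∫ y, a y ∂μ.toSphere) *
      ∫ r in Set.Ioi (0 : ℝ), r ^ (Module.finrank ℝ E - 1) * b r := by
  calc ∫ x, G x ∂μ = ∫ x : ({(0 : E)}ᶜ : Set E), G x ∂(μ.comap (↑)) := by
        rw [integral_subtype_comap (measurableSet_singleton _).compl G, restrict_compl_singleton]
    _ = ∫ z : Metric.sphere (0 : E) 1 × Set.Ioi (0 : ℝ), a z.1 * b z.2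
          ∂μ.toSphere.prod (Measure.volumeIoiPow (Module.finrank ℝ E - 1)) := by
        rw [← μ.measurePreserving_homeomorphUnitSphereProd.integral_comp
          (Homeomorph.measurableEmbedding _)]
        refine integral_congr_ae (Eventually.of_forall fun x => ?_)
        have hx : ‖(x : E)‖ ≠ 0 := norm_ne_zero_iff.2 x.2
        refine Eq.trans ?_ (hG _ _ (homeomorphUnitSphereProd E x).2.2)
        simp [smul_smul, hx]
    _ = _ := by
        rw [← integral_volumeIoiPow]
        exact integral_prod_mul a (fun r : Set.Ioi (0 : ℝ) => b r)

end PolarCoordinates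

theorem integrable_mul_of_continuousAt {X : Type*} [TopologicalSpace X] [R1Space X]
    [MeasurableSpace X] [OpensMeasurableSpace X] {μ : Measure X} [IsFiniteMeasureOnCompacts μ]
    {g b : X → ℝ} (hg : Continuous g) (hsupp : HasCompactSupport g)
    (hb : ∀ x ∈ tsupport g, ContinuousAt b x) : Integrable (fun x => g x * b x) μ :=
  Continuous.integrable_of_hasCompactSupport
    (continuous_of_tsupport fun x hx =>
      hg.continuousAt.mul (hb x (tsupport_mul_subset_left hx)))
    hsupp.mul_right

section RadialProfile

variable {χ : ℝ → ℝ}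

theorem continuous_pow_mul_inv_mul (hχ : Continuous χ) (hpos : tsupport χ ⊆ Set.Ioi 0) (k : ℕ) :
    Continuous fun r : ℝ => r ^ k * (r⁻¹ * χ r) :=
  (continuous_pow k).mul <| continuous_of_tsupport fun _ hr =>
    (continuousAt_inv₀ (hpos (tsupport_mul_subset_right hr)).ne').mul hχ.continuousAt

theorem integral_pow_mul_deriv (hχ : ContDiff ℝ 1 χ) (hsupp : HasCompactSupport χ)
    (hpos : tsupport χ ⊆ Set.Ioi 0) (k : ℕ) :
    ∫ r in Set.Ioi (0 : ℝ), r ^ k * deriv χ r =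
      -(k * ∫ r in Set.Ioi (0 : ℝ), r ^ k * (r⁻¹ * χ r)) := by
  have hpow : ContDiff ℝ 1 fun r : ℝ => r ^ k * χ r := (contDiff_id.pow k).mul hχ
  have hderiv : ∀ r ∈ Set.Ioi (0 : ℝ), deriv (fun r : ℝ => r ^ k * χ r) r =
      k * (r ^ k * (r⁻¹ * χ r)) + r ^ k * deriv χ r := fun r hr => by
    have hmul : HasDerivAt (fun r : ℝ => r ^ k * χ r) _ r :=
      (hasDerivAt_pow k r).mul (hχ.differentiable one_ne_zero r).hasDerivAt
    rw [hmul.deriv]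
    rcases k with _ | k
    · simp
    · rw [Nat.add_sub_cancel, pow_succ r k, mul_assoc (r ^ k) r (r⁻¹ * χ r),
        mul_inv_cancel_left₀ (Set.mem_Ioi.1 hr).ne', mul_assoc]
  have hint : Integrable fun r : ℝ => r ^ k * (r⁻¹ * χ r) :=
    (continuous_pow_mul_inv_mul hχ.continuous hpos k).integrable_of_hasCompactSupport
      hsupp.mul_left.mul_left
  have hint' : Integrable fun r : ℝ => r ^ k * deriv χ r :=
    ((continuous_pow k).mul (hχ.continuous_deriv le_rfl)).integrable_of_hasCompactSupport
      hsupp.deriv.mul_left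
  have hzero := hsupp.mul_left (f := fun r : ℝ => r ^ k) |>.integral_Ioi_deriv_eq hpow 0
  rw [setIntegral_congr_fun measurableSet_Ioi hderiv,
    integral_add (hint.const_mul _).integrableOn hint'.integrableOn, integral_const_mul,
    image_eq_zero_of_notMem_tsupport (f := χ) (fun h => lt_irrefl (0 : ℝ) (hpos h))] at hzero
  linarith

variable {E : Type*} [NormedAddCommGroup E]

theorem tsupport_comp_norm_subset (hpos : tsupport χ ⊆ Set.Ioi 0) :
    tsupport (fun x : E => χ ‖x‖) ⊆ {0}ᶜ :=
  (tsupport_comp_subset_preimage χ continuous_norm).trans fun _ hx =>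
    norm_pos_iff.1 (hpos hx)

theorem hasCompactSupport_comp_norm [ProperSpace E] (hsupp : HasCompactSupport χ) :
    HasCompactSupport fun x : E => χ ‖x‖ := by
  rw [hasCompactSupport_iff_eventuallyEq] at hsupp ⊢
  rw [coclosedCompact_eq_cocompact] at hsupp ⊢
  exact ((tendsto_norm_cocompact_atTop (E := E)).mono_right atTop_le_cocompact).eventually hsupp

theorem hasFDerivAt_norm [InnerProductSpace ℝ E] {x : E} (hx : x ≠ 0) :
    HasFDerivAt (fun x : E => ‖x‖) (innerSL ℝ (‖x‖⁻¹ • x)) x := by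
  have h := (hasStrictFDerivAt_norm_sq x).hasFDerivAt.sqrt
    (pow_ne_zero 2 (norm_ne_zero_iff.2 hx))
  simp only [Real.sqrt_sq (norm_nonneg _)] at h
  convert! h using 1
  rw [map_smul, ← Nat.cast_smul_eq_nsmul ℝ, smul_smul, one_div, mul_inv_rev, Nat.cast_ofNat,
    inv_mul_cancel_right₀ two_ne_zero]

theorem hasFDerivAt_comp_norm [InnerProductSpace ℝ E] (hχ : Differentiable ℝ χ)
    (hpos : tsupport χ ⊆ Set.Ioi 0) (x : E) :
    HasFDerivAt (fun x : E => χ ‖x‖) (deriv χ ‖x‖ • innerSL ℝ (‖x‖⁻¹ • x)) x := by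
  by_cases hx : x = 0
  · subst hx
    simp only [norm_zero, inv_zero, map_zero, smul_zero]
    exact (hasFDerivAt_const (0 : ℝ) 0).congr_of_eventuallyEq
      (notMem_tsupport_iff_eventuallyEq.1 fun h => tsupport_comp_norm_subset hpos h rfl)
  · exact (hχ ‖x‖).hasDerivAt.comp_hasFDerivAt x (hasFDerivAt_norm hx)

theorem integral_comp_norm_mul_fderiv [InnerProductSpace ℝ E] [FiniteDimensional ℝ E]
    [MeasurableSpace E] [BorelSpace E] (μ : Measure E) [μ.IsAddHaarMeasure] (hχ : ContDiff ℝ 1 χ)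
    (hsupp : HasCompactSupport χ) (hpos : tsupport χ ⊆ Set.Ioi 0) {F : E → ℝ}
    (hF : ∀ x ≠ 0, ContDiffAt ℝ 1 F x) (v : E) :
    ∫ x, χ ‖x‖ * fderiv ℝ F x v ∂μ = -∫ x, deriv χ ‖x‖ * (⟪‖x‖⁻¹ • x, v⟫_ℝ * F x) ∂μ := by
  have hG : ∀ x : E, HasFDerivAt (fun x : E => χ ‖x‖)
      (deriv χ ‖x‖ • innerSL ℝ (‖x‖⁻¹ • x)) x :=
    hasFDerivAt_comp_norm (hχ.differentiable one_ne_zero) hpos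
  have hderiv : ∀ x, fderiv ℝ (fun x : E => χ ‖x‖) x v * F x =
      deriv χ ‖x‖ * (⟪‖x‖⁻¹ • x, v⟫_ℝ * F x) := fun x => by
    rw [(hG x).fderiv, smul_apply, innerSL_apply_apply, smul_eq_mul, mul_assoc]
  have hint {g : ℝ → ℝ} (hg : Continuous g) (hgχ : tsupport g ⊆ tsupport χ) {b : E → ℝ}
      (hb : ∀ x ≠ 0, ContinuousAt b x) : Integrable (fun x => g ‖x‖ * b x) μ :=
    integrable_mul_of_continuousAt (hg.comp continuous_norm)
      (hasCompactSupport_comp_norm (hsupp.mono' (subset_tsupport g |>.trans hgχ)))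
      fun x hx => hb x (tsupport_comp_norm_subset (hgχ.trans hpos) hx)
  refine (integral_mul_fderiv_eq_neg_fderiv_mul_of_integrable
    (f := fun x : E => χ ‖x‖) (g := F) (v := v) ?_
    (hint hχ.continuous subset_rfl fun x hx =>
      ((hF x hx).continuousAt_fderiv one_ne_zero).clm_apply continuousAt_const)
    (hint hχ.continuous subset_rfl fun x hx => (hF x hx).continuousAt)
    (fun x _ => (hG x).differentiableAt)
    (fun x hx => (hF x (tsupport_comp_norm_subset hpos hx)).differentiableAt one_ne_zero)).trans ?_
  · simp only [hderiv]
    exact hint (hχ.continuous_deriv le_rfl) tsupport_deriv_subset fun x hx =>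
      (((continuousAt_id.norm.inv₀ (norm_ne_zero_iff.2 hx)).smul continuousAt_id).inner
        continuousAt_const).mul (hF x hx).continuousAt
  · simp only [hderiv]

end RadialProfile

/-- A bump function on `ℝ` around `1`, supported away from `0`: the radial profile along which
functions on the sphere are extended to the ambient space. -/
def radialBump : ContDiffBump (1 : ℝ) := ⟨1 / 4, 1 / 2, by norm_num, by norm_num⟩

theorem tsupport_radialBump_subset : tsupport radialBump ⊆ Set.Ioi 0 := fun t ht => by
  rw [ContDiffBump.tsupport_eq, Metric.mem_closedBall, Real.dist_eq, radialBump] at ht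
  exact Set.mem_Ioi.2 (by linarith [(abs_le.1 ht).1])

theorem integral_pow_mul_inv_mul_radialBump_pos (n : ℕ) :
    0 < ∫ r in Set.Ioi (0 : ℝ), r ^ n * (r⁻¹ * radialBump r) := by
  have hvanish : ∀ r ∉ Set.Ioi (0 : ℝ), r ^ n * (r⁻¹ * radialBump r) = 0 := fun r hr => by
    rw [image_eq_zero_of_notMem_tsupport fun h => hr (tsupport_radialBump_subset h), mul_zero,
      mul_zero]
  rw [setIntegral_eq_integral_of_forall_compl_eq_zero hvanish]
  refine Continuous.integral_pos_of_hasCompactSupport_nonneg_nonzero (x := 1)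
    (continuous_pow_mul_inv_mul radialBump.continuous tsupport_radialBump_subset n)
    radialBump.hasCompactSupport.mul_left.mul_left (fun r => ?_) ?_
  · by_cases hr : r ∈ Set.Ioi (0 : ℝ)
    · exact mul_nonneg (pow_nonneg (Set.mem_Ioi.1 hr).le n)
        (mul_nonneg (inv_nonneg.2 (Set.mem_Ioi.1 hr).le) radialBump.nonneg)
    · exact (hvanish r hr).ge
  · rw [one_pow, inv_one, one_mul, one_mul]
    exact (radialBump.pos_of_mem_ball (Metric.mem_ball_self radialBump.rOut_pos)).ne'

theorem integral_inner_grad {n : ℕ} {f : UnitSphere n → ℝ}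
    (hf : ContMDiff (𝓡 n) 𝓘(ℝ, ℝ) 1 f) (p : Ambient n) :
    ∫ y, ⟪grad n f y, p⟫_ℝ ∂(sphereVolume n) =
      n * ∫ y, ⟪(y : Ambient n), p⟫_ℝ * f y ∂(sphereVolume n) := by
  have hnorm : ∀ (y : UnitSphere n) {r : ℝ}, 0 < r → ‖r • (y : Ambient n)‖ = r := fun y r hr => by
    rw [norm_smul, norm_coe_sphere, mul_one, Real.norm_eq_abs, abs_of_pos hr]
  have hparts := integral_comp_norm_mul_fderiv volume radialBump.contDiff
    radialBump.hasCompactSupport tsupport_radialBump_subset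
    (fun x hx => contDiffAt_comp_radialProj hf hx) p
  rw [integral_eq_mul_of_polar volume (a := fun y => ⟪grad n f y, p⟫_ℝ)
      (b := fun r => r⁻¹ * radialBump r) fun y r hr => by
        rw [hnorm y hr, fderiv_comp_radialProj_smul f _ hr, inner_grad_eq_fderiv hf, smul_apply,
          smul_eq_mul]
        ring,
    integral_eq_mul_of_polar volume (a := fun y => ⟪(y : Ambient n), p⟫_ℝ * f y)
      (b := deriv radialBump) fun y r hr => by
        rw [hnorm y hr, inv_smul_smul₀ hr.ne', Function.comp_apply, radialProj_smul hr,
          radialProj_coe]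
        ring,
    integral_pow_mul_deriv radialBump.contDiff radialBump.hasCompactSupport
      tsupport_radialBump_subset, finrank_euclideanSpace_fin, Nat.add_sub_cancel] at hparts
  refine mul_right_cancel₀ (integral_pow_mul_inv_mul_radialBump_pos n).ne' (hparts.trans ?_)
  rw [sphereVolume]
  ring

/-! ### A bound from the Mittag-Leffler expansion of the cotangent -/

/-- The bound for `(1 - t cot t) / t²` that produces the constant of the Hardy inequality: the
first term of the Mittag-Leffler expansion, plus the remaining ones evaluated at `t = π`. -/
def cotBound (t : ℝ) : ℝ := 2 / (Real.pi ^ 2 - t ^ 2) + 3 / (2 * Real.pi ^ 2)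

theorem hasSum_one_div_sub_pi_mul_cot {x : ℝ} (hx : (x : ℂ) ∈ Complex.integerComplement) :
    HasSum (fun k : ℕ => 2 * x / (((k : ℝ) + 1) ^ 2 - x ^ 2))
      (1 / x - Real.pi * Real.cot (Real.pi * x)) := by
  have h := (summable_cotTerm hx).hasSum.neg
  rw [← Complex.hasSum_ofReal]
  convert! h using 1
  · funext k
    have hfac : ((x : ℂ) + (k + 1)) * (x - (k + 1)) = -(((k : ℂ) + 1) ^ 2 - (x : ℂ) ^ 2) := by ring
    rw [cotTerm_identity hx, hfac]
    push_cast
    rw [div_neg, mul_neg, neg_neg, mul_one_div]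
  · rw [show ∑' k, cotTerm (x : ℂ) k = _ from (cot_series_rep' hx).symm]
    push_cast
    ring

theorem ofReal_mem_integerComplement {x : ℝ} (h0 : 0 < x) (h1 : x < 1) :
    (x : ℂ) ∈ Complex.integerComplement := by
  rw [Complex.mem_integerComplement_iff]
  rintro ⟨k, hk⟩
  have hkx : (k : ℝ) = x := by exact_mod_cast hk
  have hk0 : 0 < k := by exact_mod_cast hkx ▸ h0
  have hk1 : k < 1 := by exact_mod_cast hkx ▸ h1
  omega

theorem hasSum_two_div_add_two_sq_sub_one :
    HasSum (fun k : ℕ => 2 / (((k : ℝ) + 2) ^ 2 - 1)) (3 / 2) := by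
  let g : ℕ → ℝ := fun k => 1 / ((k : ℝ) + 1) + 1 / (((k + 1 : ℕ) : ℝ) + 1)
  have htele : ∀ k : ℕ, 2 / (((k : ℝ) + 2) ^ 2 - 1) = g k - g (k + 1) := fun k => by
    have hk : ((k : ℝ) + 2) ^ 2 - 1 = (k + 1) * (k + 3) := by ring
    have : (0 : ℝ) ≤ k := k.cast_nonneg
    simp only [hk, g]
    push_cast
    field_simp
    ring
  have hg : Tendsto g atTop (𝓝 0) := by
    have h := tendsto_one_div_add_atTop_nhds_zero_nat (𝕜 := ℝ)
    rw [← add_zero (0 : ℝ)]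
    exact h.add (h.comp (tendsto_add_atTop_nat 1))
  rw [hasSum_iff_tendsto_nat_of_nonneg fun k => ?_]
  · simp only [htele, Finset.sum_range_sub']
    convert! tendsto_const_nhds.sub hg using 2
    norm_num [g]
  · have : (0 : ℝ) ≤ k := k.cast_nonneg
    exact div_nonneg zero_le_two (by nlinarith)

theorem one_div_sub_pi_mul_cot_le {x : ℝ} (h0 : 0 < x) (h1 : x < 1) :
    1 / x - Real.pi * Real.cot (Real.pi * x) ≤ x * (2 / (1 - x ^ 2) + 3 / 2) := by
  have htail := (hasSum_nat_add_iff' 1).2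
    (hasSum_one_div_sub_pi_mul_cot (ofReal_mem_integerComplement h0 h1))
  have hle := hasSum_le (fun k => ?_) htail (hasSum_two_div_add_two_sq_sub_one.mul_left x)
  · rw [Finset.sum_range_one, Nat.cast_zero, zero_add, one_pow] at hle
    rw [mul_add, ← mul_div_assoc x 2, mul_comm x 2]
    linarith
  · have : (0 : ℝ) ≤ k := k.cast_nonneg
    have hpos : (0 : ℝ) < ((k : ℝ) + 2) ^ 2 - 1 := by nlinarith
    push_cast
    rw [mul_comm 2 x, mul_div_assoc, add_assoc (k : ℝ) 1 1, one_add_one_eq_two]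
    gcongr
    nlinarith

theorem one_div_sq_sub_cot_div_le {t : ℝ} (h0 : 0 < t) (h1 : t < Real.pi) :
    1 / t ^ 2 - Real.cot t / t ≤ cotBound t := by
  have hpi := Real.pi_pos
  have h := one_div_sub_pi_mul_cot_le (div_pos h0 hpi) ((div_lt_one hpi).2 h1)
  rw [mul_div_cancel₀ _ hpi.ne'] at h
  have hpole : 0 < Real.pi ^ 2 - t ^ 2 := by nlinarith
  calc 1 / t ^ 2 - Real.cot t / t
      = 1 / (Real.pi * t) * (1 / (t / Real.pi) - Real.pi * Real.cot t) := by field_simp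
    _ ≤ 1 / (Real.pi * t) * (t / Real.pi * (2 / (1 - (t / Real.pi) ^ 2) + 3 / 2)) := by gcongr
    _ = cotBound t := by
      have hscale : 1 - (t / Real.pi) ^ 2 = (Real.pi ^ 2 - t ^ 2) / Real.pi ^ 2 := by field_simp
      rw [hscale, cotBound]
      field_simp

theorem cotBound_mono {t D : ℝ} (h0 : 0 ≤ t) (h : t ≤ D) (hD : D < Real.pi) :
    cotBound t ≤ cotBound D := by
  have : 0 < Real.pi ^ 2 - D ^ 2 := by nlinarith
  unfold cotBound
  gcongr

theorem cotBound_nonneg {D : ℝ} (h0 : 0 ≤ D) (hD : D < Real.pi) : 0 ≤ cotBound D := by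
  have : 0 < Real.pi ^ 2 - D ^ 2 := by nlinarith
  unfold cotBound
  positivity

theorem hardyConst_eq_mul_cotBound (n : ℕ) {β : ℝ} (h0 : 0 ≤ β) (h1 : β < Real.pi / 2) :
    hardyConst n β = ((n : ℝ) - 1) * ((n : ℝ) - 2) * cotBound (β + Real.pi / 2) := by
  have := Real.pi_pos
  have hpole : Real.pi ^ 2 - (β + Real.pi / 2) ^ 2 ≠ 0 := by nlinarith
  rw [hardyConst, cotBound]
  congr 1
  generalize β + Real.pi / 2 = D at hpole
  field_simp
  ring

/-! ### Zonal fields -/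

theorem tsupport_sq_mul_subset {X : Type*} [TopologicalSpace X] (φ g : X → ℝ) :
    tsupport (fun y => φ y ^ 2 * g y) ⊆ tsupport φ :=
  closure_mono fun z hz h0 => hz (by simp only [h0, zero_pow two_ne_zero, zero_mul])

section ZonalField

variable {n : ℕ} {h : ℝ → ℝ} {p : UnitSphere n} {φ : UnitSphere n → ℝ}

/-- The zonal field with profile `h` around `p`: the gradient of `y ↦ H ⟪y, p⟫`, where `H' = h`. -/
def zonalField (h : ℝ → ℝ) (p y : UnitSphere n) : Ambient n :=
  h ⟪(y : Ambient n), p⟫_ℝ • ((p : Ambient n) - ⟪(y : Ambient n), p⟫_ℝ • (y : Ambient n))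

/-- The divergence of the zonal field with profile `h` on `𝕊ⁿ`, as a function of `s = ⟪y, p⟫`. -/
def zonalDivergence (n : ℕ) (h : ℝ → ℝ) (s : ℝ) : ℝ :=
  deriv h s * (1 - s ^ 2) - n * s * h s

theorem norm_zonalField_sq (h : ℝ → ℝ) (p y : UnitSphere n) :
    ‖zonalField h p y‖ ^ 2 =
      h ⟪(y : Ambient n), p⟫_ℝ ^ 2 * (1 - ⟪(y : Ambient n), p⟫_ℝ ^ 2) := by
  rw [zonalField, norm_smul, mul_pow, norm_coe_sub_inner_smul_sq, Real.norm_eq_abs, sq_abs]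

theorem inner_grad_zonalField (φ : UnitSphere n → ℝ) (h : ℝ → ℝ) (p y : UnitSphere n) :
    ⟪grad n φ y, zonalField h p y⟫_ℝ =
      h ⟪(y : Ambient n), p⟫_ℝ * ⟪grad n φ y, (p : Ambient n)⟫_ℝ := by
  rw [zonalField, inner_smul_right, inner_sub_right, inner_smul_right,
    real_inner_comm (y : Ambient n) (grad n φ y), inner_coe_grad, mul_zero, sub_zero]

theorem continuous_smul_zonalField (hφ : Continuous φ)
    (hh : ∀ y ∈ tsupport φ, ContinuousAt h ⟪(y : Ambient n), p⟫_ℝ) :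
    Continuous fun y => φ y • zonalField h p y := by
  have hinner := continuous_inner_coe p
  refine continuous_of_tsupport fun y hy => hφ.continuousAt.smul ?_
  have hprofile : ContinuousAt (fun y : UnitSphere n => h ⟪(y : Ambient n), p⟫_ℝ) y :=
    (hh y (tsupport_smul_subset_left _ _ hy)).comp
      (f := fun y : UnitSphere n => ⟪(y : Ambient n), p⟫_ℝ) hinner.continuousAt
  exact hprofile.smul (continuous_const.sub (hinner.smul continuous_subtype_val)).continuousAt

theorem contMDiff_sq_mul_comp_inner (hφ : ContMDiff (𝓡 n) 𝓘(ℝ, ℝ) 1 φ)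
    (hh : ∀ y ∈ tsupport φ, ContDiffAt ℝ 1 h ⟪(y : Ambient n), p⟫_ℝ) :
    ContMDiff (𝓡 n) 𝓘(ℝ, ℝ) 1 fun y => φ y ^ 2 * h ⟪(y : Ambient n), p⟫_ℝ := by
  have hinner : ContMDiff (𝓡 n) 𝓘(ℝ, ℝ) 1 fun y : UnitSphere n => ⟪(y : Ambient n), p⟫_ℝ :=
    (contDiff_id.inner ℝ contDiff_const).contMDiff.comp contMDiff_coe_sphere
  refine contMDiff_of_tsupport fun y hy => ((hφ y).pow 2).mul ?_
  exact (hh y (tsupport_sq_mul_subset φ _ hy)).contMDiffAt.comp y (hinner y)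

theorem grad_eq_zero_of_notMem_tsupport {f : UnitSphere n → ℝ} {y : UnitSphere n}
    (hy : y ∉ tsupport f) : grad n f y = 0 :=
  (grad_eq_of_hasFDerivAt (F := fun _ => 0) (a := 0)
    (by rw [map_zero]; exact hasFDerivAt_const _ _) (notMem_tsupport_iff_eventuallyEq.1 hy)).trans
    (by simp)

theorem inner_grad_sq_mul_comp_inner (hφ : ContMDiff (𝓡 n) 𝓘(ℝ, ℝ) 1 φ) (y : UnitSphere n)
    (hh : DifferentiableAt ℝ h ⟪(y : Ambient n), p⟫_ℝ) :
    ⟪grad n (fun y => φ y ^ 2 * h ⟪(y : Ambient n), p⟫_ℝ) y, (p : Ambient n)⟫_ℝ =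
      2 * (φ y * ⟪grad n φ y, zonalField h p y⟫_ℝ) +
        φ y ^ 2 * (deriv h ⟪(y : Ambient n), p⟫_ℝ * (1 - ⟪(y : Ambient n), p⟫_ℝ ^ 2)) := by
  have hφ' := ((contDiffAt_comp_radialProj hφ (coe_sphere_ne_zero y)).differentiableAt
    one_ne_zero).hasFDerivAt
  have hprofile := HasDerivAt.comp_hasFDerivAt (h₂ := h) (y : Ambient n) hh.hasDerivAt
    (hasFDerivAt_inner_right (p : Ambient n) (y : Ambient n))
  have hproj : fderiv ℝ (φ ∘ radialProj n) y
      ((p : Ambient n) - ⟪(y : Ambient n), p⟫_ℝ • (y : Ambient n)) =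
        fderiv ℝ (φ ∘ radialProj n) y p := by
    rw [map_sub, map_smul, fderiv_comp_radialProj_self, smul_zero, sub_zero]
  have hpp : ⟪(p : Ambient n), (p : Ambient n) - ⟪(y : Ambient n), p⟫_ℝ • (y : Ambient n)⟫_ℝ =
      1 - ⟪(y : Ambient n), p⟫_ℝ ^ 2 := by
    rw [inner_sub_right, inner_smul_right, real_inner_self_eq_norm_sq, norm_coe_sphere,
      real_inner_comm (y : Ambient n) (p : Ambient n)]
    ring
  rw [inner_grad_of_hasFDerivAt ((hφ'.pow 2).mul hprofile)
    (Eventually.of_forall fun z => by simp [radialProj_coe]), inner_grad_zonalField,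
    inner_grad_eq_fderiv hφ]
  simp only [add_apply, smul_apply, smul_eq_mul, nsmul_eq_mul, hproj, innerSL_apply_apply, hpp,
    Function.comp_apply, radialProj_coe]
  push_cast
  ring

theorem inner_grad_sub_eq_zonalDivergence (hφ : ContMDiff (𝓡 n) 𝓘(ℝ, ℝ) 1 φ)
    (hh : ∀ y ∈ tsupport φ, DifferentiableAt ℝ h ⟪(y : Ambient n), p⟫_ℝ) (y : UnitSphere n) :
    ⟪grad n (fun y => φ y ^ 2 * h ⟪(y : Ambient n), p⟫_ℝ) y, (p : Ambient n)⟫_ℝ -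
        n * (⟪(y : Ambient n), p⟫_ℝ * (φ y ^ 2 * h ⟪(y : Ambient n), p⟫_ℝ)) =
      2 * (φ y * ⟪grad n φ y, zonalField h p y⟫_ℝ) +
        φ y ^ 2 * zonalDivergence n h ⟪(y : Ambient n), p⟫_ℝ := by
  by_cases hy : y ∈ tsupport φ
  · rw [inner_grad_sq_mul_comp_inner hφ y (hh y hy), zonalDivergence]
    ring
  · rw [grad_eq_zero_of_notMem_tsupport fun hy' => hy (tsupport_sq_mul_subset φ _ hy'),
      image_eq_zero_of_notMem_tsupport hy]
    simp

instance (n : ℕ) : IsFiniteMeasure (sphereVolume n) :=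
  inferInstanceAs (IsFiniteMeasure (volume : Measure (Ambient n)).toSphere)

theorem integrable_of_continuous {g : UnitSphere n → ℝ} (hg : Continuous g) :
    Integrable g (sphereVolume n) :=
  hg.integrable_of_hasCompactSupport (HasCompactSupport.of_compactSpace g)

theorem integrable_inner_grad_add_zonalDivergence (hφ : ContMDiff (𝓡 n) 𝓘(ℝ, ℝ) 1 φ)
    (hh : ∀ y ∈ tsupport φ, ContDiffAt ℝ 1 h ⟪(y : Ambient n), p⟫_ℝ) :
    Integrable (fun y => 2 * (φ y * ⟪grad n φ y, zonalField h p y⟫_ℝ) +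
      φ y ^ 2 * zonalDivergence n h ⟪(y : Ambient n), p⟫_ℝ) (sphereVolume n) := by
  have hf := contMDiff_sq_mul_comp_inner hφ hh
  simp only [← inner_grad_sub_eq_zonalDivergence hφ fun y hy => (hh y hy).differentiableAt
    one_ne_zero]
  exact integrable_of_continuous (((continuous_grad hf).inner continuous_const).sub
    (continuous_const.mul ((continuous_inner_coe p).mul hf.continuous)))

theorem integral_inner_grad_add_zonalDivergence (hφ : ContMDiff (𝓡 n) 𝓘(ℝ, ℝ) 1 φ)
    (hh : ∀ y ∈ tsupport φ, ContDiffAt ℝ 1 h ⟪(y : Ambient n), p⟫_ℝ) :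
    ∫ y, (2 * (φ y * ⟪grad n φ y, zonalField h p y⟫_ℝ) +
      φ y ^ 2 * zonalDivergence n h ⟪(y : Ambient n), p⟫_ℝ) ∂(sphereVolume n) = 0 := by
  have hf := contMDiff_sq_mul_comp_inner hφ hh
  have hdiv := integral_inner_grad hf p
  have hgrad : Integrable (fun y => ⟪grad n (fun z => φ z ^ 2 * h ⟪(z : Ambient n), p⟫_ℝ) y,
      (p : Ambient n)⟫_ℝ) (sphereVolume n) :=
    integrable_of_continuous ((continuous_grad hf).inner continuous_const)
  have hlin : Integrable (fun y : UnitSphere n =>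
      n * (⟪(y : Ambient n), p⟫_ℝ * (φ y ^ 2 * h ⟪(y : Ambient n), p⟫_ℝ))) (sphereVolume n) :=
    integrable_of_continuous (continuous_const.mul ((continuous_inner_coe p).mul hf.continuous))
  rw [← integral_const_mul, ← sub_eq_zero, ← integral_sub hgrad hlin] at hdiv
  simpa only [inner_grad_sub_eq_zonalDivergence hφ fun y hy => (hh y hy).differentiableAt
    one_ne_zero] using hdiv

theorem integrable_zonalField_remainder (hφ : ContMDiff (𝓡 n) 𝓘(ℝ, ℝ) 1 φ)
    (hh : ∀ y ∈ tsupport φ, ContinuousAt h ⟪(y : Ambient n), p⟫_ℝ) (c : ℝ) :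
    Integrable (fun y => 2 * ⟪grad n φ y, φ y • zonalField h p y⟫_ℝ -
      c * ‖φ y • zonalField h p y‖ ^ 2) (sphereVolume n) := by
  have hY := continuous_smul_zonalField hφ.continuous hh
  exact integrable_of_continuous ((continuous_const.mul ((continuous_grad hφ).inner hY)).sub
    (continuous_const.mul (hY.norm.pow 2)))

theorem neg_mul_integral_sq_le_integral_zonalField (hφ : ContMDiff (𝓡 n) 𝓘(ℝ, ℝ) 1 φ)
    (hh : ∀ y ∈ tsupport φ, ContDiffAt ℝ 1 h ⟪(y : Ambient n), p⟫_ℝ) {c κ : ℝ}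
    (hκ : ∀ y ∈ tsupport φ,
      zonalDivergence n h ⟪(y : Ambient n), p⟫_ℝ + c * ‖zonalField h p y‖ ^ 2 ≤ κ) :
    -(κ * ∫ y, φ y ^ 2 ∂(sphereVolume n)) ≤
      ∫ y, (2 * ⟪grad n φ y, φ y • zonalField h p y⟫_ℝ - c * ‖φ y • zonalField h p y‖ ^ 2)
        ∂(sphereVolume n) := by
  have hφsq : Integrable (fun y => -κ * φ y ^ 2) (sphereVolume n) :=
    integrable_of_continuous (continuous_const.mul (hφ.continuous.pow 2))
  have hdiv := integrable_inner_grad_add_zonalDivergence hφ hh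
  have hle := integral_mono (hφsq.add hdiv)
    (integrable_zonalField_remainder hφ (fun y hy => (hh y hy).continuousAt) c) fun y => ?_
  · rwa [integral_add' hφsq hdiv, integral_inner_grad_add_zonalDivergence hφ hh, add_zero,
      integral_const_mul, neg_mul] at hle
  · have hpoint : φ y ^ 2 * (zonalDivergence n h ⟪(y : Ambient n), p⟫_ℝ +
        c * ‖zonalField h p y‖ ^ 2) ≤ φ y ^ 2 * κ := by
      by_cases hy : y ∈ tsupport φ
      · exact mul_le_mul_of_nonneg_left (hκ y hy) (sq_nonneg _)
      · simp only [image_eq_zero_of_notMem_tsupport hy, zero_pow two_ne_zero, zero_mul, le_refl]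
    simp only [Pi.add_apply, inner_smul_right, norm_smul, mul_pow, Real.norm_eq_abs, sq_abs]
    linarith

end ZonalField

section Multipolar

variable {n : ℕ} {ι : Type*} [Fintype ι] [LinearOrder ι] [LocallyFiniteOrderTop ι]
  {a : ι → ℝ} {h : ℝ → ℝ} {p : ι → UnitSphere n} {φ : UnitSphere n → ℝ}

/-- The multipolar potential of the zonal fields with profile `h` around the points `p i`, with
weights `a i`. -/
def multipolarPotential (a : ι → ℝ) (h : ℝ → ℝ) (p : ι → UnitSphere n) (y : UnitSphere n) : ℝ :=
  ∑ i, ∑ j ∈ Finset.Ioi i, a i * a j * ‖zonalField h (p i) y - zonalField h (p j) y‖ ^ 2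

theorem multipolarPotential_nonneg (ha : ∀ i, 0 ≤ a i) (h : ℝ → ℝ) (p : ι → UnitSphere n)
    (y : UnitSphere n) : 0 ≤ multipolarPotential a h p y :=
  Finset.sum_nonneg fun i _ => Finset.sum_nonneg fun j _ =>
    mul_nonneg (mul_nonneg (ha i) (ha j)) (sq_nonneg _)

theorem multipolarPotential_mul (a : ι → ℝ) (h : ℝ → ℝ) (p : ι → UnitSphere n) (y : UnitSphere n)
    (t : ℝ) :
    multipolarPotential a h p y * t =
      ∑ i, ∑ j ∈ Finset.Ioi i,
        a i * a j * (‖zonalField h (p i) y - zonalField h (p j) y‖ ^ 2 * t) := by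
  simp only [multipolarPotential, Finset.sum_mul, mul_assoc]

theorem sum_sum_Ioi_norm_smul_zonalField_sub_sq (a : ι → ℝ) (h : ℝ → ℝ) (p : ι → UnitSphere n)
    (y : UnitSphere n) (t : ℝ) :
    ∑ i, ∑ j ∈ Finset.Ioi i,
        a i * a j * ‖t • zonalField h (p i) y - t • zonalField h (p j) y‖ ^ 2 =
      multipolarPotential a h p y * t ^ 2 := by
  simp only [multipolarPotential_mul, ← smul_sub, norm_smul, mul_pow, Real.norm_eq_abs, sq_abs,
    mul_comm (t ^ 2)]

theorem continuous_multipolarPotential_mul_sq (a : ι → ℝ) (hφ : Continuous φ)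
    (hh : ∀ i, ∀ y ∈ tsupport φ, ContinuousAt h ⟪(y : Ambient n), p i⟫_ℝ) :
    Continuous fun y => multipolarPotential a h p y * φ y ^ 2 := by
  have hY := fun i => continuous_smul_zonalField hφ (hh i)
  simp only [← sum_sum_Ioi_norm_smul_zonalField_sub_sq]
  exact continuous_finsetSum _ fun i _ => continuous_finsetSum _ fun j _ =>
    continuous_const.mul (((hY i).sub (hY j)).norm.pow 2)

theorem integral_multipolarPotential_mul_sq_le (ha : ∀ i, 0 ≤ a i) (hsum : ∑ i, a i = 1)
    (hφ : ContMDiff (𝓡 n) 𝓘(ℝ, ℝ) 1 φ)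
    (hh : ∀ i, ∀ y ∈ tsupport φ, ContDiffAt ℝ 1 h ⟪(y : Ambient n), p i⟫_ℝ) {c κ : ℝ}
    (hc : 0 ≤ c) (hκ : ∀ i, ∀ y ∈ tsupport φ,
      zonalDivergence n h ⟪(y : Ambient n), p i⟫_ℝ + c * ‖zonalField h (p i) y‖ ^ 2 ≤ κ) :
    c ^ 2 * ∫ y, multipolarPotential a h p y * φ y ^ 2 ∂(sphereVolume n) ≤
      ∫ y, ‖grad n φ y‖ ^ 2 ∂(sphereVolume n) + c * κ * ∫ y, φ y ^ 2 ∂(sphereVolume n) := by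
  set Y : ι → UnitSphere n → Ambient n := fun i y => φ y • zonalField h (p i) y
  set Q : ι → UnitSphere n → ℝ := fun i y =>
    2 * ⟪grad n φ y, Y i y⟫_ℝ - c * ‖Y i y‖ ^ 2
  have hQ : ∀ i, Integrable (Q i) (sphereVolume n) := fun i =>
    integrable_zonalField_remainder hφ (fun y hy => (hh i y hy).continuousAt) c
  have hgrad : Integrable (fun y => ‖grad n φ y‖ ^ 2) (sphereVolume n) :=
    integrable_of_continuous ((continuous_grad hφ).norm.pow 2)
  have hsumQ : Integrable (fun y => ∑ i, a i * (c * Q i y)) (sphereVolume n) :=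
    integrable_finsetSum _ fun i _ => ((hQ i).const_mul c).const_mul (a i)
  calc c ^ 2 * ∫ y, multipolarPotential a h p y * φ y ^ 2 ∂(sphereVolume n)
      ≤ ∫ y, (‖grad n φ y‖ ^ 2 - ∑ i, a i * (c * Q i y)) ∂(sphereVolume n) := by
        have hpotential := continuous_multipolarPotential_mul_sq a hφ.continuous
          fun i y hy => (hh i y hy).continuousAt
        rw [← integral_const_mul]
        refine integral_mono (integrable_of_continuous (continuous_const.mul hpotential))
          (hgrad.sub hsumQ) fun y => ?_
        simp only [← sum_sum_Ioi_norm_smul_zonalField_sub_sq]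
        refine (sq_mul_sum_sum_Ioi_norm_sub_sq_le hsum c (grad n φ y) fun i => Y i y).trans_eq ?_
        exact congrArg _ (Finset.sum_congr rfl fun i _ => by ring)
    _ = ∫ y, ‖grad n φ y‖ ^ 2 ∂(sphereVolume n) -
          ∑ i, a i * (c * ∫ y, Q i y ∂(sphereVolume n)) := by
        rw [integral_sub hgrad hsumQ,
          integral_finsetSum _ fun i _ => ((hQ i).const_mul c).const_mul (a i)]
        simp only [integral_const_mul]
    _ ≤ ∫ y, ‖grad n φ y‖ ^ 2 ∂(sphereVolume n) -
          ∑ i, a i * (c * -(κ * ∫ y, φ y ^ 2 ∂(sphereVolume n))) := by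
        gcongr with i _
        · exact ha i
        · exact neg_mul_integral_sq_le_integral_zonalField hφ (hh i) (hκ i)
    _ = _ := by
        rw [← Finset.sum_mul, hsum]
        ring

end Multipolar

/-! ### Cutoff near the poles -/

/-- The profile of the singular zonal field `-∇d / d`, where `d` is the distance to the pole: the
function `1 / (θ sin θ)` of `s = cos θ`. -/
def poleProfile (s : ℝ) : ℝ := (√(1 - s ^ 2) * Real.arccos s)⁻¹

/-- A smooth cutoff near the pole `s = 1`: it vanishes for `s ≥ 1 - 1 / k` and equals `1` for
`s ≤ 1 - 2 / k`. For `k = 0` it vanishes identically. -/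
def poleCutoff (k : ℕ) (s : ℝ) : ℝ := Real.smoothTransition (k * (1 - s) - 1)

/-- The regularization of `poleProfile` that vanishes near the pole. -/
def cutoffProfile (k : ℕ) (s : ℝ) : ℝ := poleCutoff k s * poleProfile s

theorem contDiff_poleCutoff (k : ℕ) : ContDiff ℝ 1 (poleCutoff k) :=
  Real.smoothTransition.contDiff.comp
    ((contDiff_const.mul (contDiff_const.sub contDiff_id)).sub contDiff_const)

theorem antitone_poleCutoff (k : ℕ) : Antitone (poleCutoff k) := fun a b hab =>
  Real.smoothTransition.monotone (by gcongr)

theorem cutoffProfile_eventuallyEq_zero (k : ℕ) {s : ℝ} (hs : 1 ≤ s) :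
    cutoffProfile k =ᶠ[𝓝 s] 0 := by
  have hcont : Continuous fun t : ℝ => (k : ℝ) * (1 - t) - 1 := by fun_prop
  have hneg : (k : ℝ) * (1 - s) - 1 < 0 := by nlinarith [k.cast_nonneg (α := ℝ)]
  filter_upwards [hcont.continuousAt.eventually_lt continuousAt_const hneg] with t ht
  rw [cutoffProfile, poleCutoff, Real.smoothTransition.zero_of_nonpos ht.le, zero_mul,
    Pi.zero_apply]

theorem eventually_cutoffProfile_eq {s : ℝ} (h1 : s < 1) :
    ∀ᶠ k : ℕ in atTop, cutoffProfile k s = poleProfile s := by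
  have hlarge : Tendsto (fun k : ℕ => (k : ℝ) * (1 - s)) atTop atTop :=
    tendsto_natCast_atTop_atTop.atTop_mul_const (sub_pos.2 h1)
  filter_upwards [hlarge.eventually_ge_atTop 2] with k hk
  rw [cutoffProfile, poleCutoff, Real.smoothTransition.one_of_one_le (by linarith), one_mul]

theorem hasDerivAt_poleProfile {s : ℝ} (h0 : -1 < s) (h1 : s < 1) :
    HasDerivAt poleProfile ((s * Real.arccos s / √(1 - s ^ 2) + 1) /
      ((1 - s ^ 2) * Real.arccos s ^ 2)) s := by
  have hsq : 0 < 1 - s ^ 2 := by nlinarith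
  have hsqrt := Real.sqrt_pos.2 hsq
  have harccos := Real.arccos_pos.2 h1
  have hinner : HasDerivAt (fun s : ℝ => 1 - s ^ 2) (-(2 * s)) s := by
    simpa using (hasDerivAt_pow 2 s).const_sub 1
  refine (((hinner.sqrt hsq.ne').mul (Real.hasDerivAt_arccos h0.ne' h1.ne)).inv
    (mul_pos hsqrt harccos).ne').congr_deriv ?_
  rw [Pi.mul_apply, mul_pow, Real.sq_sqrt hsq.le]
  field_simp
  ring

theorem contDiffAt_cutoffProfile (k : ℕ) {s : ℝ} (h0 : -1 < s) :
    ContDiffAt ℝ 1 (cutoffProfile k) s := by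
  rcases lt_or_ge s 1 with h1 | h1
  · have hsq : 0 < 1 - s ^ 2 := by nlinarith
    exact (contDiff_poleCutoff k).contDiffAt.mul
      ((((contDiffAt_const.sub (contDiffAt_id.pow 2)).sqrt hsq.ne').mul
        (Real.contDiffAt_arccos h0.ne' h1.ne)).inv
          (mul_pos (Real.sqrt_pos.2 hsq) (Real.arccos_pos.2 h1)).ne')
  · exact contDiffAt_const.congr_of_eventuallyEq (cutoffProfile_eventuallyEq_zero k h1)

theorem zonalDivergence_cutoffProfile_add (n k : ℕ) {s : ℝ} (h0 : -1 < s) (h1 : s < 1) :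
    zonalDivergence n (cutoffProfile k) s + (n - 2) * (cutoffProfile k s ^ 2 * (1 - s ^ 2)) =
      (n - 1) * (poleCutoff k s *
          (1 / Real.arccos s ^ 2 - Real.cot (Real.arccos s) / Real.arccos s)) +
        deriv (poleCutoff k) s * (√(1 - s ^ 2) / Real.arccos s) -
        (n - 2) * (poleCutoff k s * (1 - poleCutoff k s) / Real.arccos s ^ 2) := by
  have hsq : 0 < 1 - s ^ 2 := by nlinarith
  have hsqrt := Real.sqrt_pos.2 hsq
  have harccos := Real.arccos_pos.2 h1
  have hderiv : HasDerivAt (cutoffProfile k) _ s :=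
    ((contDiff_poleCutoff k).differentiable one_ne_zero s).hasDerivAt.mul
      (hasDerivAt_poleProfile h0 h1)
  rw [zonalDivergence, hderiv.deriv, cutoffProfile, poleProfile, Real.cot_eq_cos_div_sin,
    Real.cos_arccos h0.le h1.le, Real.sin_arccos]
  have hsq_sqrt : √(1 - s ^ 2) ^ 2 = 1 - s ^ 2 := Real.sq_sqrt hsq.le
  generalize √(1 - s ^ 2) = r at hsqrt hsq_sqrt ⊢
  rw [← hsq_sqrt]
  field_simp
  ring

theorem zonalDivergence_cutoffProfile_add_le {n : ℕ} (hn : 2 ≤ n) (k : ℕ) {D s : ℝ}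
    (hD : D < Real.pi) (hsD : Real.arccos s ≤ D) :
    zonalDivergence n (cutoffProfile k) s + (n - 2) * (cutoffProfile k s ^ 2 * (1 - s ^ 2)) ≤
      (n - 1) * cotBound D := by
  have hn' : (2 : ℝ) ≤ n := by exact_mod_cast hn
  have h0 : -1 < s := Real.arccos_lt_pi.1 (hsD.trans_lt hD)
  have hbound : 0 ≤ cotBound D := cotBound_nonneg ((Real.arccos_nonneg s).trans hsD) hD
  rcases lt_or_ge s 1 with h1 | h1
  · have harccos := Real.arccos_pos.2 h1
    have hχ0 : 0 ≤ poleCutoff k s := Real.smoothTransition.nonneg _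
    have hχ1 : poleCutoff k s ≤ 1 := Real.smoothTransition.le_one _
    have hcot : poleCutoff k s *
        (1 / Real.arccos s ^ 2 - Real.cot (Real.arccos s) / Real.arccos s) ≤ cotBound D :=
      (mul_le_mul_of_nonneg_left ((one_div_sq_sub_cot_div_le harccos (hsD.trans_lt hD)).trans
        (cotBound_mono harccos.le hsD hD)) hχ0).trans (mul_le_of_le_one_left hbound hχ1)
    have hderiv : deriv (poleCutoff k) s * (√(1 - s ^ 2) / Real.arccos s) ≤ 0 :=
      mul_nonpos_of_nonpos_of_nonneg (antitone_poleCutoff k).deriv_nonpos (by positivity)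
    have hcutoff : 0 ≤
        (n - 2) * (poleCutoff k s * (1 - poleCutoff k s) / Real.arccos s ^ 2) :=
      mul_nonneg (by linarith)
        (div_nonneg (mul_nonneg hχ0 (sub_nonneg.2 hχ1)) (sq_nonneg _))
    rw [zonalDivergence_cutoffProfile_add n k h0 h1]
    linarith [mul_le_mul_of_nonneg_left hcot (by linarith : (0 : ℝ) ≤ n - 1)]
  · have hzero := cutoffProfile_eventuallyEq_zero k h1
    have hrhs : 0 ≤ ((n : ℝ) - 1) * cotBound D := mul_nonneg (by linarith) hbound
    simpa [zonalDivergence, hzero.eq_of_nhds, hzero.deriv_eq] using hrhs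

/-! ### Passage to the limit -/

section Integration

variable {α : Type*} [MeasurableSpace α] {μ : Measure α}

theorem integrable_and_integral_le_of_tendsto_ae {f : ℕ → α → ℝ} {g : α → ℝ} {B : ℕ → ℝ} {b : ℝ}
    (hf : ∀ k, Integrable (f k) μ) (hf0 : ∀ k x, 0 ≤ f k x)
    (hfg : ∀ᵐ x ∂μ, Tendsto (fun k => f k x) atTop (𝓝 (g x)))
    (hB : ∀ k, ∫ x, f k x ∂μ ≤ B k) (hb : Tendsto B atTop (𝓝 b)) :
    Integrable g μ ∧ ∫ x, g x ∂μ ≤ b := by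
  have hlintegral : ∫⁻ x, ENNReal.ofReal (g x) ∂μ ≤ ENNReal.ofReal b :=
    calc ∫⁻ x, ENNReal.ofReal (g x) ∂μ
        = ∫⁻ x, liminf (fun k => ENNReal.ofReal (f k x)) atTop ∂μ :=
          lintegral_congr_ae (hfg.mono fun x hx => (ENNReal.tendsto_ofReal hx).liminf_eq.symm)
      _ ≤ liminf (fun k => ∫⁻ x, ENNReal.ofReal (f k x) ∂μ) atTop :=
          lintegral_liminf_le' fun k => (hf k).aemeasurable.ennreal_ofReal
      _ ≤ liminf (fun k => ENNReal.ofReal (B k)) atTop :=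
          liminf_le_liminf (Eventually.of_forall fun k => by
            rw [← ofReal_integral_eq_lintegral_ofReal (hf k) (ae_of_all _ (hf0 k))]
            exact ENNReal.ofReal_le_ofReal (hB k))
      _ = ENNReal.ofReal b := (ENNReal.tendsto_ofReal hb).liminf_eq
  have hg0 : 0 ≤ᵐ[μ] g := hfg.mono fun x hx => ge_of_tendsto' hx fun k => hf0 k x
  have hg : Integrable g μ :=
    ⟨aestronglyMeasurable_of_tendsto_ae _ (fun k => (hf k).aestronglyMeasurable) hfg,
      (hasFiniteIntegral_iff_ofReal hg0).2 (hlintegral.trans_lt ENNReal.ofReal_lt_top)⟩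
  have hb0 : 0 ≤ b := ge_of_tendsto' hb fun k => (integral_nonneg (hf0 k)).trans (hB k)
  refine ⟨hg, (ENNReal.ofReal_le_ofReal_iff hb0).1 ?_⟩
  rwa [ofReal_integral_eq_lintegral_ofReal hg hg0]

theorem tendsto_integral_norm_sq {E : Type*} [NormedAddCommGroup E] {f : ℕ → α → E} {g : α → E}
    (hf : ∀ k, MemLp (f k) 2 μ) (hg : MemLp g 2 μ)
    (hfg : Tendsto (fun k => eLpNorm (f k - g) 2 μ) atTop (𝓝 0)) :
    Tendsto (fun k => ∫ x, ‖f k x‖ ^ 2 ∂μ) atTop (𝓝 (∫ x, ‖g x‖ ^ 2 ∂μ)) := by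
  have norm_toLp_sq {h : α → E} (hh : MemLp h 2 μ) : ‖hh.toLp h‖ ^ 2 = ∫ x, ‖h x‖ ^ 2 ∂μ := by
    rw [Lp.norm_toLp, toReal_eLpNorm hh.aestronglyMeasurable,
      lpNorm_eq_integral_norm_rpow_toReal two_ne_zero ENNReal.ofNat_ne_top
        hh.aestronglyMeasurable, ENNReal.toReal_ofNat]
    simp only [Real.rpow_ofNat]
    exact Real.rpow_inv_natCast_pow (integral_nonneg fun x => by positivity) two_ne_zero
  simp only [← norm_toLp_sq (hf _), ← norm_toLp_sq hg]
  exact ((Lp.tendsto_Lp_iff_tendsto_eLpNorm'' f hf g hg).2 hfg).norm.pow 2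

theorem integrable_of_integrable_finsetSum {ι : Type*} {s : Finset ι} {f : ι → α → ℝ}
    (hmeas : ∀ i ∈ s, AEStronglyMeasurable (f i) μ) (hf0 : ∀ i ∈ s, ∀ x, 0 ≤ f i x)
    (hsum : Integrable (fun x => ∑ i ∈ s, f i x) μ) {i : ι} (hi : i ∈ s) :
    Integrable (f i) μ :=
  hsum.mono' (hmeas i hi) (ae_of_all _ fun x => by
    rw [Real.norm_of_nonneg (hf0 i hi x)]
    exact Finset.single_le_sum (f := fun j => f j x) (fun j hj => hf0 j hj x) hi)

end Integration

section SphereVolume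

variable {n : ℕ}

open scoped Pointwise in
theorem sphereVolume_singleton (hn : n ≠ 0) (p : UnitSphere n) : sphereVolume n {p} = 0 := by
  have hspan : (ℝ ∙ (p : Ambient n)) ≠ ⊤ := fun h => hn <| by
    have hfinrank := finrank_span_singleton (K := ℝ) (coe_sphere_ne_zero p)
    rw [h, finrank_top, Fact.out (p := Module.finrank ℝ (Ambient n) = n + 1)] at hfinrank
    omega
  have hcone : Set.Ioo (0 : ℝ) 1 • ((↑) '' ({p} : Set (UnitSphere n)) : Set (Ambient n)) ⊆
      (ℝ ∙ (p : Ambient n) : Submodule ℝ (Ambient n)) := by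
    rintro _ ⟨r, -, _, ⟨_, rfl, rfl⟩, rfl⟩
    exact Submodule.smul_mem _ _ (Submodule.mem_span_singleton_self _)
  rw [sphereVolume, Measure.toSphere_apply' _ (measurableSet_singleton p),
    measure_mono_null hcone (Measure.addHaar_submodule _ _ hspan), mul_zero]

theorem ae_ne_sphereVolume (hn : n ≠ 0) (p : UnitSphere n) :
    ∀ᵐ y ∂(sphereVolume n), y ≠ p := by
  rw [ae_iff]
  simpa only [not_not, Set.ofPred_eq_eq_singleton] using sphereVolume_singleton hn p

theorem ae_mem_upperHemisphere (n : ℕ) : ∀ᵐ y ∂(hemisphereVolume n), y ∈ upperHemisphere n := by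
  have hcont : Continuous fun y : UnitSphere n => (y : Ambient n) (Fin.last n) := by fun_prop
  exact ae_restrict_mem (isOpen_lt continuous_const hcont).measurableSet

theorem integral_hemisphereVolume_eq {φ g : UnitSphere n → ℝ} (hφ : tsupport φ ⊆ upperHemisphere n)
    (hg : ∀ y, y ∉ tsupport φ → g y = 0) :
    ∫ y, g y ∂(hemisphereVolume n) = ∫ y, g y ∂(sphereVolume n) :=
  setIntegral_eq_integral_of_forall_compl_eq_zero fun y hy => hg y fun h => hy (hφ h)

end SphereVolume

section PoleField

variable {n : ℕ} {p q y : UnitSphere n}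

theorem measurable_poleProfile : Measurable poleProfile :=
  ((measurable_const.sub (measurable_id.pow_const 2)).sqrt.mul Real.measurable_arccos).inv

theorem measurable_zonalField {h : ℝ → ℝ} (hh : Measurable h) (p : UnitSphere n) :
    Measurable (zonalField h p) := by
  have hinner := (continuous_inner_coe p).measurable
  exact (hh.comp hinner).smul (measurable_const.sub (hinner.smul measurable_subtype_coe))

theorem inv_geodDist_smul_grad (h : -1 < ⟪(y : Ambient n), p⟫_ℝ) (hne : y ≠ p) :
    (geodDist n y p)⁻¹ • grad n (fun z => geodDist n z p) y = -zonalField poleProfile p y := by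
  rw [geodDist_eq_arccos h, grad_geodDist h (inner_coe_lt_one hne), smul_smul, zonalField,
    poleProfile, mul_inv, mul_neg, neg_smul, mul_comm]

theorem bipolarPotential_eq (hp : -1 < ⟪(y : Ambient n), p⟫_ℝ) (hyp : y ≠ p)
    (hq : -1 < ⟪(y : Ambient n), q⟫_ℝ) (hyq : y ≠ q) :
    bipolarPotential n p q y = ‖zonalField poleProfile p y - zonalField poleProfile q y‖ ^ 2 := by
  rw [bipolarPotential, inv_geodDist_smul_grad hp hyp, inv_geodDist_smul_grad hq hyq,
    neg_sub_neg, norm_sub_rev]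

theorem bipolarPotential_ae_eq (hn : n ≠ 0) (hp : p ∈ upperHemisphere n)
    (hq : q ∈ upperHemisphere n) :
    bipolarPotential n p q =ᵐ[hemisphereVolume n]
      fun y => ‖zonalField poleProfile p y - zonalField poleProfile q y‖ ^ 2 := by
  filter_upwards [ae_mem_upperHemisphere n, ae_restrict_of_ae (ae_ne_sphereVolume hn p),
    ae_restrict_of_ae (ae_ne_sphereVolume hn q)] with y hy hyp hyq
  exact bipolarPotential_eq (neg_one_lt_inner_of_mem_upperHemisphere hy hp) hyp
    (neg_one_lt_inner_of_mem_upperHemisphere hy hq) hyq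

theorem eventually_zonalField_cutoffProfile_eq (hne : y ≠ p) :
    ∀ᶠ k in atTop, zonalField (cutoffProfile k) p y = zonalField poleProfile p y :=
  (eventually_cutoffProfile_eq (inner_coe_lt_one hne)).mono fun k hk => by
    rw [zonalField, hk, zonalField]

end PoleField

section MultipolarHardyInequality

variable {n : ℕ} {ι : Type*} [Fintype ι] [LinearOrder ι] [LocallyFiniteOrderTop ι]
  {a : ι → ℝ} {p : ι → UnitSphere n} {D : ℝ}

theorem eventually_multipolarPotential_cutoffProfile_eq (a : ι → ℝ) {y : UnitSphere n}
    (hy : ∀ i, y ≠ p i) :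
    ∀ᶠ k in atTop, multipolarPotential a (cutoffProfile k) p y =
      multipolarPotential a poleProfile p y := by
  filter_upwards [eventually_all.2 fun i => eventually_zonalField_cutoffProfile_eq (hy i)]
    with k hk
  simp only [multipolarPotential, hk]

theorem integral_multipolarPotential_cutoffProfile_le (hn : 2 ≤ n) (ha : ∀ i, 0 ≤ a i)
    (hsum : ∑ i, a i = 1) {φ : UnitSphere n → ℝ} (hφ : ContMDiff (𝓡 n) 𝓘(ℝ, ℝ) 1 φ)
    (hD : D < Real.pi) (hpD : ∀ i, ∀ y ∈ tsupport φ, Real.arccos ⟪(y : Ambient n), p i⟫_ℝ ≤ D)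
    (k : ℕ) :
    ((n : ℝ) - 2) ^ 2 *
        ∫ y, multipolarPotential a (cutoffProfile k) p y * φ y ^ 2 ∂(sphereVolume n) ≤
      ∫ y, ‖grad n φ y‖ ^ 2 ∂(sphereVolume n) +
        (n - 2) * ((n - 1) * cotBound D) * ∫ y, φ y ^ 2 ∂(sphereVolume n) := by
  have hn' : (0 : ℝ) ≤ n - 2 := sub_nonneg.2 (by exact_mod_cast hn)
  refine integral_multipolarPotential_mul_sq_le ha hsum hφ (fun i y hy => ?_) hn' fun i y hy => ?_
  · exact contDiffAt_cutoffProfile k (Real.arccos_lt_pi.1 ((hpD i y hy).trans_lt hD))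
  · rw [norm_zonalField_sq]
    exact zonalDivergence_cutoffProfile_add_le hn k hD (hpD i y hy)

theorem integral_multipolarPotential_poleProfile_le (hn : 2 ≤ n) (ha : ∀ i, 0 ≤ a i)
    (hsum : ∑ i, a i = 1) {φ : UnitSphere n → ℝ} (hφ : ContMDiff (𝓡 n) 𝓘(ℝ, ℝ) 1 φ)
    (hD : D < Real.pi) (hpD : ∀ i, ∀ y ∈ tsupport φ, Real.arccos ⟪(y : Ambient n), p i⟫_ℝ ≤ D) :
    Integrable (fun y => ((n : ℝ) - 2) ^ 2 * (multipolarPotential a poleProfile p y * φ y ^ 2))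
        (sphereVolume n) ∧
      ∫ y, ((n : ℝ) - 2) ^ 2 * (multipolarPotential a poleProfile p y * φ y ^ 2)
          ∂(sphereVolume n) ≤
        ∫ y, ‖grad n φ y‖ ^ 2 ∂(sphereVolume n) +
          (n - 2) * ((n - 1) * cotBound D) * ∫ y, φ y ^ 2 ∂(sphereVolume n) := by
  have hcont (k : ℕ) : Continuous fun y => multipolarPotential a (cutoffProfile k) p y * φ y ^ 2 :=
    continuous_multipolarPotential_mul_sq a hφ.continuous fun i y hy =>
      (contDiffAt_cutoffProfile k (Real.arccos_lt_pi.1 ((hpD i y hy).trans_lt hD))).continuousAt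
  have hne : ∀ᵐ y ∂(sphereVolume n), ∀ i, y ≠ p i :=
    ae_all_iff.2 fun i => ae_ne_sphereVolume (by omega) (p i)
  refine integrable_and_integral_le_of_tendsto_ae
    (fun k => (integrable_of_continuous (hcont k)).const_mul (((n : ℝ) - 2) ^ 2))
    (fun k y => mul_nonneg (sq_nonneg _)
      (mul_nonneg (multipolarPotential_nonneg ha _ p y) (sq_nonneg _)))
    ?_ (fun k => ?_) tendsto_const_nhds
  · filter_upwards [hne] with y hy
    refine tendsto_const_nhds.congr' ?_
    filter_upwards [eventually_multipolarPotential_cutoffProfile_eq a hy] with k hk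
    rw [hk]
  · rw [integral_const_mul]
    exact integral_multipolarPotential_cutoffProfile_le hn ha hsum hφ hD hpD k

instance (n : ℕ) : IsFiniteMeasure (hemisphereVolume n) :=
  inferInstanceAs (IsFiniteMeasure ((sphereVolume n).restrict (upperHemisphere n)))

theorem memLp_of_continuous {E : Type*} [NormedAddCommGroup E] {g : UnitSphere n → E}
    (hg : Continuous g) : MemLp g 2 (hemisphereVolume n) :=
  hg.memLp_of_hasCompactSupport (HasCompactSupport.of_compactSpace g)

theorem IsTestFunction.integral_multipolarPotential_le (hn : 2 ≤ n) (ha : ∀ i, 0 ≤ a i)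
    (hsum : ∑ i, a i = 1) {φ : UnitSphere n → ℝ} (hφ : IsTestFunction n φ) (hD : D < Real.pi)
    (hpD : ∀ i, ∀ y ∈ upperHemisphere n, Real.arccos ⟪(y : Ambient n), p i⟫_ℝ ≤ D) :
    Integrable (fun y => ((n : ℝ) - 2) ^ 2 * (multipolarPotential a poleProfile p y * φ y ^ 2))
        (hemisphereVolume n) ∧
      ∫ y, ((n : ℝ) - 2) ^ 2 * (multipolarPotential a poleProfile p y * φ y ^ 2)
          ∂(hemisphereVolume n) ≤
        ∫ y, ‖grad n φ y‖ ^ 2 ∂(hemisphereVolume n) +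
          (n - 2) * ((n - 1) * cotBound D) * ∫ y, φ y ^ 2 ∂(hemisphereVolume n) := by
  obtain ⟨hint, hle⟩ := integral_multipolarPotential_poleProfile_le hn ha hsum
    (hφ.1.of_le (by simp)) hD fun i y hy => hpD i y (hφ.2 hy)
  have hzero : ∀ y, y ∉ tsupport φ → φ y ^ 2 = 0 := fun y hy => by
    rw [image_eq_zero_of_notMem_tsupport hy, zero_pow two_ne_zero]
  refine ⟨hint.restrict, ?_⟩
  rwa [integral_hemisphereVolume_eq hφ.2 fun y hy => by rw [hzero y hy, mul_zero, mul_zero],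
    integral_hemisphereVolume_eq hφ.2 fun y hy => by
      rw [grad_eq_zero_of_notMem_tsupport hy, norm_zero, zero_pow two_ne_zero],
    integral_hemisphereVolume_eq hφ.2 hzero]

theorem MemSobolev.integral_multipolarPotential_le (hn : 2 ≤ n) (ha : ∀ i, 0 ≤ a i)
    (hsum : ∑ i, a i = 1) {u : UnitSphere n → ℝ} {V : UnitSphere n → Ambient n}
    (hu : MemSobolev n u V) (hD : D < Real.pi)
    (hpD : ∀ i, ∀ y ∈ upperHemisphere n, Real.arccos ⟪(y : Ambient n), p i⟫_ℝ ≤ D) :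
    Integrable (fun y => ((n : ℝ) - 2) ^ 2 * (multipolarPotential a poleProfile p y * u y ^ 2))
        (hemisphereVolume n) ∧
      ∫ y, ((n : ℝ) - 2) ^ 2 * (multipolarPotential a poleProfile p y * u y ^ 2)
          ∂(hemisphereVolume n) ≤
        ∫ y, ‖V y‖ ^ 2 ∂(hemisphereVolume n) +
          (n - 2) * ((n - 1) * cotBound D) * ∫ y, u y ^ 2 ∂(hemisphereVolume n) := by
  obtain ⟨hmemu, hmemV, φ, hφ, hφu, hφV⟩ := hu
  have hφmem (k : ℕ) : MemLp (φ k) 2 (hemisphereVolume n) :=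
    memLp_of_continuous (hφ k).1.continuous
  have hgradmem (k : ℕ) : MemLp (grad n (φ k)) 2 (hemisphereVolume n) :=
    memLp_of_continuous (continuous_grad ((hφ k).1.of_le (by simp)))
  have hφsq : Tendsto (fun k => ∫ y, φ k y ^ 2 ∂(hemisphereVolume n)) atTop
      (𝓝 (∫ y, u y ^ 2 ∂(hemisphereVolume n))) := by
    simpa only [Real.norm_eq_abs, sq_abs] using tendsto_integral_norm_sq hφmem hmemu hφu
  have hbound := (tendsto_integral_norm_sq hgradmem hmemV hφV).add
    (hφsq.const_mul ((n - 2) * ((n - 1) * cotBound D)))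
  obtain ⟨k, hk, hae⟩ := (tendstoInMeasure_of_tendsto_eLpNorm two_ne_zero
    (fun k => (hφmem k).aestronglyMeasurable) hmemu.aestronglyMeasurable hφu).exists_seq_tendsto_ae
  refine integrable_and_integral_le_of_tendsto_ae
    (fun l => ((hφ (k l)).integral_multipolarPotential_le hn ha hsum hD hpD).1)
    (fun l y => mul_nonneg (sq_nonneg _)
      (mul_nonneg (multipolarPotential_nonneg ha _ p y) (sq_nonneg _)))
    ?_ (fun l => ((hφ (k l)).integral_multipolarPotential_le hn ha hsum hD hpD).2)
    (hbound.comp hk.tendsto_atTop)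
  filter_upwards [hae] with y hy
  exact ((hy.pow 2).const_mul _).const_mul _

end MultipolarHardyInequality

theorem geodDist_northPole_mem_Ico {n : ℕ} {p : UnitSphere n} (hp : p ∈ upperHemisphere n) :
    geodDist n (northPole n) p ∈ Set.Ico 0 (Real.pi / 2) := by
  rw [geodDist_northPole hp]
  exact ⟨Real.arccos_nonneg _, arccos_inner_northPole_lt hp⟩

theorem arccos_inner_le_geodDist_add {n : ℕ} {y p : UnitSphere n} (hy : y ∈ upperHemisphere n)
    (hp : p ∈ upperHemisphere n) :
    Real.arccos ⟪(y : Ambient n), p⟫_ℝ ≤ geodDist n (northPole n) p + Real.pi / 2 := by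
  rw [geodDist_northPole hp]
  exact (arccos_inner_lt_of_mem_upperHemisphere hy).le

section Bipolar

variable {n : ℕ} {ι : Type*} [Fintype ι] [LinearOrder ι] [LocallyFiniteOrderTop ι]
  {a : ι → ℝ} {p : ι → UnitSphere n} {u : UnitSphere n → ℝ}

theorem multipolarPotential_poleProfile_mul_ae_eq (hn : n ≠ 0) (a : ι → ℝ)
    (hp : ∀ i, p i ∈ upperHemisphere n) (u : UnitSphere n → ℝ) :
    (fun y => multipolarPotential a poleProfile p y * u y ^ 2) =ᵐ[hemisphereVolume n]
      fun y => ∑ i, ∑ j ∈ Finset.Ioi i,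
        a i * a j * (bipolarPotential n (p i) (p j) y * u y ^ 2) := by
  filter_upwards [ae_all_iff.2 fun i => ae_all_iff.2 fun j =>
    bipolarPotential_ae_eq hn (hp i) (hp j)] with y hy
  simp only [multipolarPotential_mul, hy]

theorem aestronglyMeasurable_bipolarPotential_mul_sq (hn : n ≠ 0) {p q : UnitSphere n}
    (hp : p ∈ upperHemisphere n) (hq : q ∈ upperHemisphere n)
    (hu : AEStronglyMeasurable u (hemisphereVolume n)) :
    AEStronglyMeasurable (fun y => bipolarPotential n p q y * u y ^ 2) (hemisphereVolume n) := by
  have hpole := measurable_zonalField (n := n) measurable_poleProfile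
  exact (((hpole p).sub (hpole q)).norm.pow_const 2).aestronglyMeasurable.congr
    (bipolarPotential_ae_eq hn hp hq).symm |>.mul (hu.pow 2)

theorem integrable_bipolarPotential_mul_sq (hn : n ≠ 0) (ha : ∀ i, 0 < a i)
    (hp : ∀ i, p i ∈ upperHemisphere n) (hu : AEStronglyMeasurable u (hemisphereVolume n))
    (hint : Integrable (fun y => multipolarPotential a poleProfile p y * u y ^ 2)
      (hemisphereVolume n)) {i j : ι} (hij : i < j) :
    Integrable (fun y => bipolarPotential n (p i) (p j) y * u y ^ 2) (hemisphereVolume n) := by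
  have hmeas (i j : ι) : AEStronglyMeasurable
      (fun y => a i * a j * (bipolarPotential n (p i) (p j) y * u y ^ 2)) (hemisphereVolume n) :=
    (aestronglyMeasurable_bipolarPotential_mul_sq hn (hp i) (hp j) hu).const_mul _
  have hnonneg (i j : ι) (y : UnitSphere n) :
      0 ≤ a i * a j * (bipolarPotential n (p i) (p j) y * u y ^ 2) :=
    mul_nonneg (mul_pos (ha i) (ha j)).le (mul_nonneg (sq_nonneg _) (sq_nonneg _))
  have hrow : Integrable (fun y => ∑ j ∈ Finset.Ioi i,
      a i * a j * (bipolarPotential n (p i) (p j) y * u y ^ 2)) (hemisphereVolume n) :=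
    integrable_of_integrable_finsetSum
      (fun i _ => Finset.aestronglyMeasurable_fun_sum _ fun j _ => hmeas i j)
      (fun i _ y => Finset.sum_nonneg fun j _ => hnonneg i j y)
      (hint.congr (multipolarPotential_poleProfile_mul_ae_eq hn a hp u)) (Finset.mem_univ i)
  have hterm := integrable_of_integrable_finsetSum (fun j _ => hmeas i j)
    (fun j _ => hnonneg i j) hrow (Finset.mem_Ioi.2 hij)
  exact (integrable_const_mul_iff (mul_pos (ha i) (ha j)).ne'.isUnit _).1 hterm

theorem integral_multipolarPotential_poleProfile_mul_sq (hn : n ≠ 0) (a : ι → ℝ)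
    (hp : ∀ i, p i ∈ upperHemisphere n)
    (hint : ∀ i j, i < j → Integrable (fun y => bipolarPotential n (p i) (p j) y * u y ^ 2)
      (hemisphereVolume n)) :
    ∫ y, multipolarPotential a poleProfile p y * u y ^ 2 ∂(hemisphereVolume n) =
      ∑ i, ∑ j ∈ Finset.Ioi i,
        a i * a j * ∫ y, bipolarPotential n (p i) (p j) y * u y ^ 2 ∂(hemisphereVolume n) := by
  have hterm (i j : ι) (hij : j ∈ Finset.Ioi i) : Integrable
      (fun y => a i * a j * (bipolarPotential n (p i) (p j) y * u y ^ 2)) (hemisphereVolume n) :=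
    (hint i j (Finset.mem_Ioi.1 hij)).const_mul _
  rw [integral_congr_ae (multipolarPotential_poleProfile_mul_ae_eq hn a hp u),
    integral_finsetSum _ fun i _ => integrable_finsetSum _ (hterm i)]
  refine Finset.sum_congr rfl fun i _ => ?_
  rw [integral_finsetSum _ (hterm i)]
  simp only [integral_const_mul]

end Bipolar

end

end MultipolarHardy

theorem mainTheorem6_general {n : ℕ} (hn : 3 ≤ n) {ι : Type*} [Fintype ι] [LinearOrder ι]
    [LocallyFiniteOrderTop ι] {a : ι → ℝ} (ha : ∀ i, 0 < a i) (hsum : ∑ i, a i = 1)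
    {p : ι → MultipolarHardy.UnitSphere n} (hp : ∀ i, p i ∈ MultipolarHardy.upperHemisphere n)
    {β : ℝ} (hβ : IsGreatest
      (Set.range fun i => MultipolarHardy.geodDist n (MultipolarHardy.northPole n) (p i)) β)
    {u : MultipolarHardy.UnitSphere n → ℝ}
    {V : MultipolarHardy.UnitSphere n → MultipolarHardy.Ambient n}
    (hu : MultipolarHardy.MemSobolev n u V) :
    (∀ i j, i < j →
      Integrable (fun y => MultipolarHardy.bipolarPotential n (p i) (p j) y * u y ^ 2)
        (MultipolarHardy.hemisphereVolume n)) ∧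
    ((n : ℝ) - 2) ^ 2 * ∑ i, ∑ j ∈ Finset.Ioi i, a i * a j *
        ∫ y, MultipolarHardy.bipolarPotential n (p i) (p j) y * u y ^ 2
          ∂(MultipolarHardy.hemisphereVolume n) ≤
      ∫ y, ‖V y‖ ^ 2 ∂(MultipolarHardy.hemisphereVolume n) +
        MultipolarHardy.hardyConst n β *
          ∫ y, u y ^ 2 ∂(MultipolarHardy.hemisphereVolume n) := by
  obtain ⟨hβ0, hβ1⟩ : β ∈ Set.Ico 0 (Real.pi / 2) := by
    obtain ⟨i, rfl⟩ := hβ.1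
    exact MultipolarHardy.geodDist_northPole_mem_Ico (hp i)
  have hn' : (n : ℝ) - 2 ≠ 0 := sub_ne_zero.2 (by exact_mod_cast show n ≠ 2 by omega)
  obtain ⟨hint, hle⟩ := hu.integral_multipolarPotential_le (D := β + Real.pi / 2)
    (by omega) (fun i => (ha i).le) hsum (by linarith) fun i y hy =>
      (MultipolarHardy.arccos_inner_le_geodDist_add hy (hp i)).trans
        (add_le_add_left (hβ.2 (Set.mem_range_self i)) _)
  have hpair (i j : ι) (hij : i < j) :=
    MultipolarHardy.integrable_bipolarPotential_mul_sq (by omega) ha hp hu.1.aestronglyMeasurable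
      ((integrable_const_mul_iff (pow_ne_zero 2 hn').isUnit _).1 hint) hij
  refine ⟨hpair, ?_⟩
  rw [integral_const_mul,
    MultipolarHardy.integral_multipolarPotential_poleProfile_mul_sq (by omega) a hp hpair] at hle
  rw [MultipolarHardy.hardyConst_eq_mul_cotBound n hβ0 hβ1]
  exact hle.trans_eq (by ring)

theorem mainTheorem6 (n m : ℕ) (hn : 3 ≤ n) (hm : 2 ≤ m)
    (p : Fin m → MultipolarHardy.UnitSphere n) (hp : Function.Injective p)
    (hpS : ∀ i, p i ∈ MultipolarHardy.upperHemisphere n)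
    (β : ℝ)
    (hβ : IsGreatest
      (Set.range fun i => MultipolarHardy.geodDist n (MultipolarHardy.northPole n) (p i)) β)
    (u : MultipolarHardy.UnitSphere n → ℝ)
    (V : MultipolarHardy.UnitSphere n → MultipolarHardy.Ambient n)
    (hu : MultipolarHardy.MemSobolev n u V) :
    (∀ i j : Fin m, i < j →
      Integrable (fun y => MultipolarHardy.bipolarPotential n (p i) (p j) y * u y ^ 2)
        (MultipolarHardy.hemisphereVolume n)) ∧
    ((n : ℝ) - 2) ^ 2 / (m : ℝ) ^ 2 *
        ∑ i : Fin m, ∑ j ∈ Finset.Ioi i,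
          ∫ y, MultipolarHardy.bipolarPotential n (p i) (p j) y * u y ^ 2
            ∂(MultipolarHardy.hemisphereVolume n) ≤
      (∫ y, ‖V y‖ ^ 2 ∂(MultipolarHardy.hemisphereVolume n)) +
        MultipolarHardy.hardyConst n β *
          ∫ y, u y ^ 2 ∂(MultipolarHardy.hemisphereVolume n) := by
  have hm' : (0 : ℝ) < m := by exact_mod_cast show 0 < m by omega
  simpa only [← Finset.mul_sum, ← mul_assoc, div_eq_mul_inv, sq, mul_inv] using
    mainTheorem6_general (a := fun _ => (m : ℝ)⁻¹) hn (fun _ => inv_pos.2 hm')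
      (by simp [hm'.ne']) hpS hβ hu
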